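/- All systems are finite-dimensional; $\mathcal D(A)$ denotes the density matrices of a system $A$. Let $\mathfrak F$ be a quantum resource theory with a tensor product structure: to every pair of systems it assigns a closed set $\mathfrak F(A\to B)$ of quantum channels (completely positive trace-preserving maps), such that identity channels are free, compositions of free channels are free, $\mathrm{id}_C\otimes\mathcal M\in\mathfrak F(CA\to CB)$ and $\mathcal M\otimes\mathrm{id}_C\in\mathfrak F(AC\to BC)$ for $\mathcal M\in\mathfrak F(A\to B)$, and $\mathfrak F(A\to 1)\neq\emptyset$, where $1$ is the trivial system; $(AB)C$ is identified with $A(BC)$, and $1A$ and $A1$ with $A$. The free states are $\mathfrak F(A):=\mathfrak F(1\to A)\subseteq\mathcal D(A)$. Let $d$ assign to every pair of states of the same system a value in $[0,\infty]$ such that 1. $d(\Phi(\rho),\Phi(\sigma))\le d(\rho,\sigma)$ for every quantum channel $\Phi$; 2. $d\big(\sum_x p_x\rho_x\otimes|x\rangle\langle x|,\ \sum_x p_x\sigma_x\otimes|x\rangle\langle x|\big)\ \ge\ \sum_x p_x\,d(\rho_x,\sigma_x)$ for all finite families of states $\rho_x,\sigma_x$ and all probability distributions $p$, with $\{|x\rangle\}$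 an orthonormal basis of an auxiliary system; 3. $d$ is convex in its second argument; 4. either $d$ is real-valued (no value is $\infty$; in this case nothing else is assumed), or $d$ is lower semicontinuous in its second argument. Let $A,B$ be systems such that $\mathfrak F(A\to B)$ is convex, and let $\mathcal N$ be a quantum channel from $A$ to $B$. Then $$\inf_{\mathcal M\in\mathfrak F(A\to B)}\ \sup_{R,\ \rho\in\mathcal S(RA)} d\big(\mathcal N_{A\to B}(\rho_{RA}),\mathcal M_{A\to B}(\rho_{RA})\big)\;=\;\sup_{R,\ \rho\in\mathcal S(RA)}\ \inf_{\mathcal M\in\mathfrak F(A\to B)} d\big(\mathcal N_{A\to B}(\rho_{RA}),\mathcal M_{A\to B}(\rho_{RA})\big),$$ where the suprema run over all ancilla systems $R$, with no bound on the dimension, in each of the two cases * $\mathcal S(RA)=\mathcal D(RA)$ (all states); * $\mathcal S(RA)=\mathfrak F(RA)$ (free states), provided that $\mathfrak F(A\to B)$ is non-empty, that $\mathfrak F(RA)$ is convex for every $R$, and that for some system $R$ the set $\mathfrak F(R)$ contains two orthonormal pure states. Moreover, under the same assumptions on $\mathfrak F$, both equalities hold when $d$ is the relative entropy $D(\rho\|\sigma)=\mathrm{Tr}[\rho\log\rho-\rho\log\sigma]$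 (equal to $\infty$ if the support of $\rho$ is not contained in that of $\sigma$). That is, the values of $$D_{\mathfrak F}(\mathcal N)=\inf_{\mathcal M\in\mathfrak F(A\to B)}\sup_{R,\,\rho\in\mathcal D(RA)}D\big(\mathcal N(\rho_{RA})\|\mathcal M(\rho_{RA})\big),\qquad E_{\mathfrak F}(\mathcal N)=\inf_{\mathcal M\in\mathfrak F(A\to B)}\sup_{R,\,\rho\in\mathfrak F(RA)}D\big(\mathcal N(\rho_{RA})\|\mathcal M(\rho_{RA})\big)$$ do not change when the infimum and the supremum are swapped. -/

import Mathlib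

open scoped ENNReal Kronecker ComplexOrder

namespace QRT

universe u

/-! ### States and channels -/

/-- The density matrices on the finite-dimensional Hilbert space with orthonormal basis `ι`. -/
@[ext]
structure State (ι : Type) [Fintype ι] where
  /-- the density matrix -/
  mat : Matrix ι ι ℂ
  posSemidef : mat.PosSemidef
  trace_eq_one : mat.trace = 1

noncomputable instance (ι : Type) [Fintype ι] : TopologicalSpace (State ι) :=
  TopologicalSpace.induced State.mat inferInstance

/-- The map `id_R ⊗ Φ`: the map `Φ` is applied to each block of a block matrix. -/
def ampliate {ι κ : Type} (R : Type) (Φ : Matrix ι ι ℂ →ₗ[ℂ] Matrix κ κ ℂ) :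
    Matrix (R × ι) (R × ι) ℂ →ₗ[ℂ] Matrix (R × κ) (R × κ) ℂ where
  toFun X := Matrix.of fun i j => Φ (X.submatrix (Prod.mk i.1) (Prod.mk j.1)) i.2 j.2
  map_add' X Y := by
    ext i j
    simp [Matrix.submatrix_add]
  map_smul' c X := by
    ext i j
    simp [Matrix.submatrix_smul]

/-- Complete positivity: every `id_R ⊗ Φ` with `R` finite-dimensional preserves positivity. -/
def IsCompletelyPositive {ι κ : Type} (Φ : Matrix ι ι ℂ →ₗ[ℂ] Matrix κ κ ℂ) : Prop :=
  ∀ (R : Type) [Fintype R] (X : Matrix (R × ι) (R × ι) ℂ),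
    X.PosSemidef → (ampliate R Φ X).PosSemidef

/-- Quantum channels: completely positive trace preserving maps. -/
@[ext]
structure Channel (ι κ : Type) [Fintype ι] [Fintype κ] where
  /-- the underlying linear map -/
  toLin : Matrix ι ι ℂ →ₗ[ℂ] Matrix κ κ ℂ
  completelyPositive : IsCompletelyPositive toLin
  trace_map : ∀ X, (toLin X).trace = X.trace

/-- The topology of pointwise convergence; since everything is finite-dimensional, this is the
topology of any norm on the space of linear maps. -/
noncomputable instance (ι κ : Type) [Fintype ι] [Fintype κ] : TopologicalSpace (Channel ι κ) :=
  TopologicalSpace.induced (fun Φ X => Φ.toLin X) inferInstance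

namespace Channel

variable {ι κ μ : Type} [Fintype ι] [Fintype κ] [Fintype μ]

/-- The output state of a channel. -/
def apply (Φ : Channel ι κ) (ρ : State ι) : State κ where
  mat := Φ.toLin ρ.mat
  posSemidef := by
    have h := Φ.completelyPositive Unit (ρ.mat.submatrix Prod.snd Prod.snd)
      (ρ.posSemidef.submatrix _)
    exact h.submatrix (Prod.mk ())
  trace_eq_one := by rw [Φ.trace_map, ρ.trace_eq_one]

/-- The identity channel. -/
protected def id (ι : Type) [Fintype ι] : Channel ι ι where
  toLin := LinearMap.id
  completelyPositive := fun _ _ _ hX => hX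
  trace_map _ := rfl

/-- Composition of channels, `Ψ ∘ Φ`. -/
def comp (Ψ : Channel κ μ) (Φ : Channel ι κ) : Channel ι μ where
  toLin := Ψ.toLin ∘ₗ Φ.toLin
  completelyPositive := fun R _ X hX =>
    Ψ.completelyPositive R _ (Φ.completelyPositive R X hX)
  trace_map X := by simp [Ψ.trace_map, Φ.trace_map]

/-- The channel that identifies two spaces through a bijection of their bases. -/
def relabel (e : ι ≃ κ) : Channel ι κ where
  toLin := (Matrix.reindexLinearEquiv ℂ ℂ e e).toLinearMap
  completelyPositive := fun R _ X hX =>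
    hX.submatrix (fun i : R × κ => (i.1, e.symm i.2))
  trace_map X := by
    simp only [LinearEquiv.coe_coe, Matrix.coe_reindexLinearEquiv, Matrix.trace,
      Matrix.diag_apply, Matrix.submatrix_apply, Matrix.reindex_apply]
    exact Equiv.sum_comp e.symm (fun i => X i i)

/-- The channel `id_R ⊗ Φ`. -/
def tensorLeft (R : Type) [Fintype R] (Φ : Channel ι κ) : Channel (R × ι) (R × κ) where
  toLin := ampliate R Φ.toLin
  completelyPositive := fun Q _ X hX => by
    have h := Φ.completelyPositive (Q × R) (X.submatrix (Equiv.prodAssoc Q R ι)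
      (Equiv.prodAssoc Q R ι)) (hX.submatrix _)
    exact h.submatrix (Equiv.prodAssoc Q R κ).symm
  trace_map X := by
    have h : ∀ r : R, ∑ b, Φ.toLin (X.submatrix (Prod.mk r) (Prod.mk r)) b b
        = ∑ a, X (r, a) (r, a) := fun r =>
      Φ.trace_map (X.submatrix (Prod.mk r) (Prod.mk r))
    simp only [Matrix.trace, Matrix.diag_apply, Fintype.sum_prod_type]
    exact Finset.sum_congr rfl fun r _ => h r

/-- The channel `Φ ⊗ id_R`. -/
def tensorRight (R : Type) [Fintype R] (Φ : Channel ι κ) : Channel (ι × R) (κ × R) :=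
  (relabel (Equiv.prodComm R κ)).comp ((Φ.tensorLeft R).comp (relabel (Equiv.prodComm ι R)))

end Channel

namespace State

variable {ι X : Type} [Fintype ι] [Fintype X]

/-- The unique state of the trivial system. -/
def unit : State Unit where
  mat := 1
  posSemidef := Matrix.PosSemidef.one
  trace_eq_one := by simp

/-- The mixture `∑ₓ pₓ ρₓ`. -/
def mix (p : stdSimplex ℝ X) (ρ : X → State ι) : State ι where
  mat := ∑ x, (p.1 x : ℂ) • (ρ x).mat
  posSemidef := Matrix.posSemidef_sum _ fun x _ =>
    (ρ x).posSemidef.smul (by exact_mod_cast p.2.1 x)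
  trace_eq_one := by
    simp only [Matrix.trace_sum, Matrix.trace_smul, (ρ _).trace_eq_one, smul_eq_mul, mul_one]
    exact_mod_cast p.2.2

open Classical in
/-- The orthogonally flagged mixture `∑ₓ pₓ ρₓ ⊗ |x⟩⟨x|`. -/
noncomputable def flag (p : stdSimplex ℝ X) (ρ : X → State ι) : State (ι × X) where
  mat := ∑ x, (p.1 x : ℂ) • ((ρ x).mat ⊗ₖ Matrix.single x x 1)
  posSemidef := Matrix.posSemidef_sum _ fun x _ =>
    Matrix.PosSemidef.smul ((ρ x).posSemidef.kronecker (by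
      rw [← Matrix.diagonal_single]
      exact Matrix.PosSemidef.diagonal (Pi.single_nonneg.2 zero_le_one)))
      (by exact_mod_cast p.2.1 x)
  trace_eq_one := by
    simp only [Matrix.trace_sum, Matrix.trace_smul, Matrix.trace_kronecker,
      (ρ _).trace_eq_one, Matrix.trace_single_eq_same, smul_eq_mul, mul_one]
    exact_mod_cast p.2.2

end State

/-! ### State divergences -/

/-- A function that assigns a value in `[0, ∞]` to every pair of states of one system. -/
abbrev StateFunction : Type 1 :=
  ∀ (ι : Type) [Fintype ι], State ι → State ι → ℝ≥0∞

namespace StateFunction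

/-- Monotonicity under all quantum channels. -/
def IsContractive (d : StateFunction) : Prop :=
  ∀ (ι κ : Type) [Fintype ι] [Fintype κ] (Φ : Channel ι κ) (ρ σ : State ι),
    d κ (Φ.apply ρ) (Φ.apply σ) ≤ d ι ρ σ

/-- Joint concavity under orthogonally flagged mixtures. -/
def IsFlagConcave (d : StateFunction) : Prop :=
  ∀ (ι X : Type) [Fintype ι] [Fintype X] (p : stdSimplex ℝ X) (ρ σ : X → State ι),
    ∑ x, ENNReal.ofReal (p.1 x) * d ι (ρ x) (σ x) ≤ d (ι × X) (State.flag p ρ) (State.flag p σ)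

/-- Convexity in the second argument. -/
def IsConvexSnd (d : StateFunction) : Prop :=
  ∀ (ι X : Type) [Fintype ι] [Fintype X] (p : stdSimplex ℝ X) (ρ : State ι) (σ : X → State ι),
    d ι ρ (State.mix p σ) ≤ ∑ x, ENNReal.ofReal (p.1 x) * d ι ρ (σ x)

/-- All values are finite, that is, the function is real-valued. -/
def IsFinite (d : StateFunction) : Prop :=
  ∀ (ι : Type) [Fintype ι] (ρ σ : State ι), d ι ρ σ ≠ ∞

/-- Lower semicontinuity in the second argument. -/
def IsLscSnd (d : StateFunction) : Prop :=
  ∀ (ι : Type) [Fintype ι] (ρ : State ι), LowerSemicontinuous (d ι ρ)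

end StateFunction

open Classical in
/-- The quantum relative entropy `D(ρ‖σ) = Tr[ρ log ρ - ρ log σ]`, and `∞` if the support of `ρ`
is not contained in the support of `σ`. The matrix logarithm is taken with `log 0 = 0`, which
does not matter on the supports; the trace is real and non-negative (Klein's inequality). -/
noncomputable def relEntropy : StateFunction := fun ι _ ρ σ =>
  if ∀ v : ι → ℂ, σ.mat.mulVec v = 0 → ρ.mat.mulVec v = 0 then
    ENNReal.ofReal (ρ.mat * cfc Real.log ρ.mat - ρ.mat * cfc Real.log σ.mat).trace.re
  else ∞

/-! ### Physical systems and quantum resource theories -/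

/-- Physical systems: the trivial one, the elementary ones (labelled by `S`), and composites. -/
inductive PhysSystem (S : Type u) : Type u
  | trivial : PhysSystem S
  | elem (s : S) : PhysSystem S
  | tensor (A B : PhysSystem S) : PhysSystem S

/-- The orthonormal basis of the Hilbert space of a system; an elementary system `s` has
dimension `dim s ≥ 1`. -/
def PhysSystem.Idx {S : Type u} (dim : S → ℕ+) : PhysSystem S → Type
  | .trivial => Unit
  | .elem s => Fin (dim s)
  | .tensor A B => A.Idx dim × B.Idx dim

/-- The basis of a system is finite. -/
@[reducible] def PhysSystem.fintypeIdx {S : Type u} (dim : S → ℕ+) :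
    (A : PhysSystem S) → Fintype (A.Idx dim)
  | .trivial => inferInstanceAs (Fintype Unit)
  | .elem s => inferInstanceAs (Fintype (Fin (dim s)))
  | .tensor A B =>
    letI := A.fintypeIdx dim
    letI := B.fintypeIdx dim
    inferInstanceAs (Fintype (A.Idx dim × B.Idx dim))

instance {S : Type u} (dim : S → ℕ+) (A : PhysSystem S) : Fintype (A.Idx dim) :=
  A.fintypeIdx dim

open PhysSystem in
/-- A quantum resource theory with a tensor product structure: a set `free A B` of free channels
for every pair of systems. The last five fields say that bracketing and trivial
tensor factors do not matter: `(AB)C` is identified with `A(BC)`, and `1A` and `A1` with `A`. -/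
structure ResourceTheory {S : Type u} (dim : S → ℕ+) where
  /-- the free channels from `A` to `B` -/
  free : (A B : PhysSystem S) → Set (Channel (A.Idx dim) (B.Idx dim))
  id_mem : ∀ A, Channel.id (A.Idx dim) ∈ free A A
  comp_mem : ∀ {A B C}, ∀ M ∈ free A B, ∀ N ∈ free B C, N.comp M ∈ free A C
  tensorLeft_mem : ∀ {A B} (C), ∀ M ∈ free A B,
    M.tensorLeft (C.Idx dim) ∈ free (tensor C A) (tensor C B)
  tensorRight_mem : ∀ {A B} (C), ∀ M ∈ free A B,
    M.tensorRight (C.Idx dim) ∈ free (tensor A C) (tensor B C)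
  discard_nonempty : ∀ A, (free A trivial).Nonempty
  isClosed_free : ∀ A B, IsClosed (free A B)
  assoc_mem : ∀ A B C, Channel.relabel (Equiv.prodAssoc (A.Idx dim) (B.Idx dim) (C.Idx dim)) ∈
    free (tensor (tensor A B) C) (tensor A (tensor B C))
  assoc_symm_mem : ∀ A B C,
    Channel.relabel (Equiv.prodAssoc (A.Idx dim) (B.Idx dim) (C.Idx dim)).symm ∈
      free (tensor A (tensor B C)) (tensor (tensor A B) C)
  leftUnit_mem : ∀ A, Channel.relabel (Equiv.punitProd (A.Idx dim)) ∈ free (tensor trivial A) A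
  leftUnit_symm_mem : ∀ A,
    Channel.relabel (Equiv.punitProd (A.Idx dim)).symm ∈ free A (tensor trivial A)
  rightUnit_mem : ∀ A, Channel.relabel (Equiv.prodPUnit (A.Idx dim)) ∈ free (tensor A trivial) A
  rightUnit_symm_mem : ∀ A,
    Channel.relabel (Equiv.prodPUnit (A.Idx dim)).symm ∈ free A (tensor A trivial)

namespace ResourceTheory

variable {S : Type u} {dim : S → ℕ+}

/-- The free states of `A`: the states prepared by the free channels from the trivial system. -/
def freeStates (F : ResourceTheory dim) (A : PhysSystem S) : Set (State (A.Idx dim)) :=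
  (fun Φ => Φ.apply State.unit) '' F.free .trivial A

/-- The set of free channels from `A` to `B` is convex. -/
def ConvexChannels (F : ResourceTheory dim) (A B : PhysSystem S) : Prop :=
  Convex ℝ (Channel.toLin '' F.free A B)

/-- The set of free states of `A` is convex. -/
def ConvexStates (F : ResourceTheory dim) (A : PhysSystem S) : Prop :=
  Convex ℝ (State.mat '' F.freeStates A)

/-- Some system has two orthonormal pure states that are both free. -/
def HasFreeFlags (F : ResourceTheory dim) : Prop :=
  ∃ (R : PhysSystem S) (ψ φ : R.Idx dim → ℂ), star ψ ⬝ᵥ φ = 0 ∧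
    (∃ ρ ∈ F.freeStates R, ρ.mat = Matrix.vecMulVec ψ (star ψ)) ∧
    (∃ ρ ∈ F.freeStates R, ρ.mat = Matrix.vecMulVec φ (star φ))

variable (F : ResourceTheory dim) (A B : PhysSystem S) (d : StateFunction)
  (N : Channel (A.Idx dim) (B.Idx dim))

/-- `inf_M sup_ρ d(N(ρ), M(ρ))`, over the free channels `M` from `A` to `B`, and over all states
`ρ` on `RA` for all finite-dimensional ancillas `R`. -/
noncomputable def infSupAll : ℝ≥0∞ :=
  ⨅ M ∈ F.free A B, ⨆ (r : ℕ) (ρ : State (Fin r × A.Idx dim)),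
    d (Fin r × B.Idx dim) ((N.tensorLeft (Fin r)).apply ρ) ((M.tensorLeft (Fin r)).apply ρ)

/-- `sup_ρ inf_M d(N(ρ), M(ρ))` with the same ranges. -/
noncomputable def supInfAll : ℝ≥0∞ :=
  ⨆ (r : ℕ) (ρ : State (Fin r × A.Idx dim)), ⨅ M ∈ F.free A B,
    d (Fin r × B.Idx dim) ((N.tensorLeft (Fin r)).apply ρ) ((M.tensorLeft (Fin r)).apply ρ)

/-- `inf_M sup_ρ d(N(ρ), M(ρ))`, over the free channels `M` from `A` to `B`, and over the free
states `ρ` on `RA` for all systems `R`. -/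
noncomputable def infSupFree : ℝ≥0∞ :=
  ⨅ M ∈ F.free A B, ⨆ (R : PhysSystem S), ⨆ ρ ∈ F.freeStates (.tensor R A),
    d (R.Idx dim × B.Idx dim) ((N.tensorLeft (R.Idx dim)).apply ρ)
      ((M.tensorLeft (R.Idx dim)).apply ρ)

/-- `sup_ρ inf_M d(N(ρ), M(ρ))` with the same ranges. -/
noncomputable def supInfFree : ℝ≥0∞ :=
  ⨆ (R : PhysSystem S), ⨆ ρ ∈ F.freeStates (.tensor R A), ⨅ M ∈ F.free A B,
    d (R.Idx dim × B.Idx dim) ((N.tensorLeft (R.Idx dim)).apply ρ)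
      ((M.tensorLeft (R.Idx dim)).apply ρ)

/-- The relative entropy `D_F(N)` of the dynamical resource `N`, optimized over all states. -/
noncomputable def relEntropyAll : ℝ≥0∞ := F.infSupAll A B relEntropy N

/-- The relative entropy `E_F(N)` of the dynamical resource `N`, optimized over free states. -/
noncomputable def relEntropyFree : ℝ≥0∞ := F.infSupFree A B relEntropy N

end ResourceTheory

end QRT

/-! Only `inf sup ≤ sup inf` needs work, and it is a minimax theorem in the variables `M` (free
channel) and `ρ` (test state). The channels form a compact set, so the closed convex set of free
ones is compact, and `d(N(ρ), M(ρ))` is convex in `M`. No linear concavity in `ρ` is available, but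
Ky Fan's theorem asks only for concave-likeness: given `ρ₁`, `ρ₂` and weights `a`, `b`, one test
state whose value is at least the weighted average for all `M` at once. The unbounded ancilla
supplies it: take the mixture of `ρ₁` and `ρ₂` flagged by orthonormal vectors `ψ`, `φ`, after
padding each with a state of the other's ancilla so that both live on one space
(`IsAncillaStable.add_le`). In the free case flags and padding states are free, and convexity of the
free states makes the mixture free.

If `d` is lower semicontinuous in its second argument, `iInf_iSup_le_iSup_iInf` applies directly. A
real-valued `d` need not be so, but contractivity bounds it by a constant `K`. A bounded convex
function becomes lower semicontinuous after its domain is shrunk by a factor `1 - ε` towards a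
relative interior point; this costs at most `ε * K` in the minimax inequality, and `ε` tends to `0`
(`iInf_iSup_le_iSup_iInf_of_le`).

For the relative entropy, data processing is not needed: the minimax argument uses only
`IsAncillaStable`, convexity and lower semicontinuity. The first follows from a formula in
eigenvalues and overlaps of eigenbases (`relEntropy_eq_sum`). The other two follow by writing the
relative entropy as a supremum of functions with second argument `σ + ε`, which are continuous, and
convex because the logarithm is operator concave. -/

namespace QRT

/-! ### Ky Fan's minimax theorem for values in `[0, ∞]` -/

open NNReal in
theorem exists_weighted_sum_le {X Y : Type*} {f : X → Y → ℝ≥0∞}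
    (hconc : ∀ y₁ y₂ (a b : ℝ≥0), a + b = 1 → ∃ y, ∀ x, a * f x y₁ + b * f x y₂ ≤ f x y)
    {ι : Type*} (s : Finset ι) (y : ι → Y) (p : ι → ℝ≥0) (hp : ∑ i ∈ s, p i = 1) :
    ∃ z, ∀ x, ∑ i ∈ s, (p i : ℝ≥0∞) * f x (y i) ≤ f x z := by
  classical
  induction s using Finset.induction_on generalizing p with
  | empty => simp at hp
  | insert i s hi ih =>
    rw [Finset.sum_insert hi] at hp
    by_cases h0 : ∑ j ∈ s, p j = 0
    · refine ⟨y i, fun x => ?_⟩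
      have h1 : p i = 1 := by simpa [h0] using hp
      have h2 : ∑ j ∈ s, (p j : ℝ≥0∞) * f x (y j) = 0 := by
        refine Finset.sum_eq_zero fun j hj => ?_
        rw [Finset.sum_eq_zero_iff] at h0
        simp [h0 j hj]
      rw [Finset.sum_insert hi, h2, h1]
      simp
    · set c := ∑ j ∈ s, p j with hc
      obtain ⟨z, hz⟩ := ih (fun j => p j / c) (by rw [← Finset.sum_div, div_self h0])
      obtain ⟨w, hw⟩ := hconc (y i) z (p i) c hp
      refine ⟨w, fun x => le_trans ?_ (hw x)⟩
      rw [Finset.sum_insert hi]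
      gcongr
      refine le_trans ?_ (mul_le_mul_right (hz x) (c : ℝ≥0∞))
      rw [Finset.mul_sum]
      refine Finset.sum_le_sum fun j _ => ?_
      rw [← mul_assoc, ← ENNReal.coe_mul, mul_div_cancel₀ _ h0]

/-- The positive weights in the finite case of the minimax theorem. -/
theorem exists_weights_of_forall_exists_lt {X ι : Type*} [Fintype ι] [Nonempty X]
    {g : X → ι → ℝ≥0∞}
    (hconv : ∀ x₁ x₂ (a b : NNReal), a + b = 1 → ∃ x, ∀ i, g x i ≤ a * g x₁ i + b * g x₂ i)
    {α β : NNReal} (hβ : β < α) (h : ∀ x, ∃ i, (α : ℝ≥0∞) < g x i) :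
    ∃ p : ι → NNReal, ∑ i, p i = 1 ∧ ∀ x, (β : ℝ≥0∞) ≤ ∑ i, (p i : ℝ≥0∞) * g x i := by
  classical
  have hne : Nonempty ι := ⟨(h (Classical.arbitrary X)).choose⟩
  obtain ⟨n, hn⟩ : ∃ n : ℝ, n = Fintype.card ι := ⟨_, rfl⟩
  have hn0 : 0 < n := by simp [hn, Fintype.card_pos]
  obtain ⟨q, hq0, hq1, hq⟩ : ∃ q : ι → ℝ, (∀ i, 0 ≤ q i) ∧ ∑ i, q i = 1 ∧
      ∀ x, (∀ i, g x i ≠ ∞) → (α : ℝ) ≤ ∑ i, q i * (g x i).toReal := by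
    -- `C` is the strict upper set of the finite rows of `g`. It is open and convex and misses the
    -- constant vector `α`; the weights `q` are a normalized separating functional. If `C` is empty,
    -- every row has an infinite entry and any weights do.
    set C : Set (ι → ℝ) := {t | ∃ x, ∀ i, g x i ≠ ∞ ∧ (g x i).toReal < t i} with hC
    by_cases hemp : C.Nonempty
    swap
    · refine ⟨fun _ => 1 / n, fun _ => by positivity, by simp [← hn, hn0.ne'], fun x hx => ?_⟩
      exact (hemp ⟨fun i => (g x i).toReal + 1, x, fun i => ⟨hx i, by linarith⟩⟩).elim
    have hopen : IsOpen C := by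
      have : C = ⋃ x, ⋃ (_ : ∀ i, g x i ≠ ∞), Set.pi Set.univ fun i => Set.Ioi (g x i).toReal := by
        ext t
        simp only [hC, Set.mem_ofPred_eq, Set.mem_iUnion, Set.mem_pi, Set.mem_univ, true_imp_iff,
          Set.mem_Ioi, exists_prop, forall_and]
      rw [this]
      exact isOpen_iUnion fun x => isOpen_iUnion fun _ =>
        isOpen_set_pi Set.finite_univ fun i _ => isOpen_Ioi
    have hcvx : Convex ℝ C := by
      rintro t ⟨x₁, h₁⟩ u ⟨x₂, h₂⟩ a b ha hb hab
      lift a to NNReal using ha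
      lift b to NNReal using hb
      obtain ⟨x, hx⟩ := hconv x₁ x₂ a b (by exact_mod_cast hab)
      have hfin : ∀ i, (a : ℝ≥0∞) * g x₁ i + (b : ℝ≥0∞) * g x₂ i ≠ ∞ := fun i => ENNReal.add_ne_top.2 ⟨ENNReal.mul_ne_top ENNReal.coe_ne_top (h₁ i).1,
            ENNReal.mul_ne_top ENNReal.coe_ne_top (h₂ i).1⟩
      refine ⟨x, fun i => ⟨ne_top_of_le_ne_top (hfin i) (hx i), ?_⟩⟩
      have := ENNReal.toReal_mono (hfin i) (hx i)
      rw [ENNReal.toReal_add (ENNReal.mul_ne_top ENNReal.coe_ne_top (h₁ i).1)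
        (ENNReal.mul_ne_top ENNReal.coe_ne_top (h₂ i).1), ENNReal.toReal_mul,
        ENNReal.toReal_mul, ENNReal.coe_toReal, ENNReal.coe_toReal] at this
      refine this.trans_lt ?_
      simp only [Pi.add_apply, Pi.smul_apply, smul_eq_mul]
      rcases a.2.eq_or_lt with ha | ha
      · have ha0 : (a : ℝ) = 0 := ha.symm
        have hb1 : (b : ℝ) = 1 := by rw [ha0] at hab; linarith
        simpa [ha0, hb1] using (h₂ i).2
      · have e1 := mul_lt_mul_of_pos_left (h₁ i).2 ha
        have e2 := mul_le_mul_of_nonneg_left (h₂ i).2.le b.2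
        exact add_lt_add_of_lt_of_le e1 e2
    have hnot : (fun _ => (α : ℝ)) ∉ C := by
      rintro ⟨x, hx⟩
      obtain ⟨i, hi⟩ := h x
      have := ENNReal.toReal_strict_mono (hx i).1 hi
      rw [ENNReal.coe_toReal] at this
      exact lt_asymm this (hx i).2
    obtain ⟨L, hL⟩ := geometric_hahn_banach_open_point hcvx hopen hnot
    set c : ι → ℝ := fun i => - L (Pi.single i 1) with hc
    have hLc : ∀ t, L t = - ∑ i, c i * t i := by
      intro t
      conv_lhs => rw [pi_eq_sum_univ' t]
      simp only [map_sum, map_smul, hc, smul_eq_mul, neg_mul, Finset.sum_neg_distrib, neg_neg]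
      exact Finset.sum_congr rfl fun i _ => mul_comm _ _
    have hup : ∀ t ∈ C, (α : ℝ) * ∑ i, c i < ∑ i, c i * t i := by
      intro t ht
      have := hL t ht
      rw [hLc, hLc, ← Finset.sum_mul] at this
      linarith
    obtain ⟨t₀, x₀, ht₀⟩ := hemp
    have hc0 : ∀ i, 0 ≤ c i := by
      intro i
      by_contra hneg
      push Not at hneg
      set D := ∑ j, c j * t₀ j - (α : ℝ) * ∑ j, c j with hD
      have hDpos : 0 < D := by have := hup t₀ ⟨x₀, ht₀⟩; simp only [hD]; linarith
      have hs : 0 ≤ D / (- c i) := div_nonneg hDpos.le (by linarith)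
      -- `C` is closed under increasing a coordinate. If `c i < 0`, raising coordinate `i` by `D /
      -- (-c i)` lowers the functional by exactly its margin `D` over the bound, which contradicts
      -- strict separation.
      have hmem : (fun j => t₀ j + if j = i then D / (- c i) else 0) ∈ C := by
        refine ⟨x₀, fun j => ⟨(ht₀ j).1, (ht₀ j).2.trans_le ?_⟩⟩
        beta_reduce
        split_ifs <;> linarith
      have := hup _ hmem
      simp only [mul_add, Finset.sum_add_distrib, mul_ite, mul_zero, Finset.sum_ite_eq',
        Finset.mem_univ, if_true] at this
      have h3 : c i * (D / (- c i)) = - D := by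
        rw [div_neg, mul_neg, mul_div_cancel₀ _ hneg.ne]
      rw [h3] at this
      linarith
    have hcs : 0 < ∑ i, c i := by
      refine (Finset.sum_nonneg fun i _ => hc0 i).lt_of_ne fun hz => ?_
      have hz' : ∀ i, c i = 0 := fun i =>
        (Finset.sum_eq_zero_iff_of_nonneg fun i _ => hc0 i).1 hz.symm i (Finset.mem_univ i)
      have := hup t₀ ⟨x₀, ht₀⟩
      simp [hz'] at this
    refine ⟨fun i => c i / ∑ j, c j, fun i => div_nonneg (hc0 i) hcs.le,
      by rw [← Finset.sum_div, div_self hcs.ne'], fun x hx => ?_⟩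
    refine le_of_forall_pos_le_add fun δ hδ => ?_
    have h4 := hup (fun i => (g x i).toReal + δ) ⟨x, fun i => ⟨hx i, by linarith⟩⟩
    simp only [mul_add, Finset.sum_add_distrib, ← Finset.sum_mul] at h4
    simp only [div_mul_eq_mul_div, ← Finset.sum_div]
    rw [← sub_le_iff_le_add, le_div_iff₀ hcs]
    nlinarith
  -- Mixing `q` with the uniform weights makes every weight positive, so that a row with an infinite
  -- entry has an infinite sum (otherwise `0 * ∞ = 0` could intervene). The factor `1 - ε` lost on
  -- finite rows is paid for by `β < α`; the choice below gives `(1 - ε) * α = (α + β) / 2`.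
  obtain ⟨ε, hε0, hε1, hε⟩ : ∃ ε : ℝ, 0 < ε ∧ ε < 1 ∧ (β : ℝ) ≤ (1 - ε) * α := by
    have hβ' : (β : ℝ) < α := by exact_mod_cast hβ
    have hα : (0 : ℝ) < α := lt_of_le_of_lt β.2 hβ'
    refine ⟨(α - β) / (2 * α), by apply div_pos <;> linarith, ?_, ?_⟩
    · rw [div_lt_one (by linarith)]
      have : (0 : ℝ) ≤ β := β.2
      linarith
    · have : (1 - (α - β) / (2 * α)) * α = (α + β : ℝ) / 2 := by field_simp; ring
      rw [this]; linarith
  have hp0 : ∀ i, 0 < (1 - ε) * q i + ε / n := fun i =>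
    add_pos_of_nonneg_of_pos (mul_nonneg (by linarith) (hq0 i)) (by positivity)
  obtain ⟨r, hr⟩ : ∃ r : ι → NNReal, ∀ i, (r i : ℝ) = (1 - ε) * q i + ε / n :=
    ⟨fun i => Real.toNNReal _, fun i => Real.coe_toNNReal _ (hp0 i).le⟩
  refine ⟨r, ?_, fun x => ?_⟩
  · ext
    rw [NNReal.coe_sum]
    simp only [hr, NNReal.coe_one, Finset.sum_add_distrib, ← Finset.mul_sum, hq1,
      Finset.sum_const, Finset.card_univ, nsmul_eq_mul, ← hn]
    field_simp
    ring
  · by_cases hx : ∀ i, g x i ≠ ∞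
    · have hfin : ∀ i ∈ Finset.univ, (r i : ℝ≥0∞) * g x i ≠ ∞ := fun i _ => ENNReal.mul_ne_top ENNReal.coe_ne_top (hx i)
      rw [← ENNReal.toReal_le_toReal ENNReal.coe_ne_top (ENNReal.sum_ne_top.2 hfin),
        ENNReal.toReal_sum hfin]
      simp only [ENNReal.toReal_mul, ENNReal.coe_toReal, hr, add_mul, mul_assoc,
        Finset.sum_add_distrib, ← Finset.mul_sum]
      have h5 := mul_le_mul_of_nonneg_left (hq x hx) (sub_nonneg.2 hε1.le)
      have h6 : 0 ≤ ε / n * ∑ i, (g x i).toReal :=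
        mul_nonneg (by positivity) (Finset.sum_nonneg fun i _ => ENNReal.toReal_nonneg)
      linarith
    · push Not at hx
      obtain ⟨i, hi⟩ := hx
      refine le_top.trans (le_trans ?_ (Finset.single_le_sum (fun _ _ => zero_le)
        (Finset.mem_univ i)))
      rw [hi, ENNReal.mul_top]
      simp only [ne_eq, ENNReal.coe_eq_zero]
      intro h7
      have h8 := hr i
      rw [h7] at h8
      exact (hp0 i).ne h8

/-- The minimax theorem of Ky Fan for functions with values in `[0, ∞]`: `X` is compact, `f` is
lower semicontinuous and convex-like in the first, and concave-like in the second variable. -/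
theorem iInf_iSup_le_iSup_iInf {X Y : Type*} [TopologicalSpace X] [CompactSpace X] [Nonempty X]
    {f : X → Y → ℝ≥0∞} (hlsc : ∀ y, LowerSemicontinuous fun x => f x y)
    (hconv : ∀ x₁ x₂ (a b : NNReal), a + b = 1 → ∃ x, ∀ y, f x y ≤ a * f x₁ y + b * f x₂ y)
    (hconc : ∀ y₁ y₂ (a b : NNReal), a + b = 1 → ∃ y, ∀ x, a * f x y₁ + b * f x y₂ ≤ f x y) :
    ⨅ x, ⨆ y, f x y ≤ ⨆ y, ⨅ x, f x y := by
  refine le_of_forall_lt fun c hc => ?_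
  obtain ⟨β, hcβ, hβ⟩ := ENNReal.lt_iff_exists_nnreal_btwn.1 hc
  obtain ⟨α, hβα, hα⟩ := ENNReal.lt_iff_exists_nnreal_btwn.1 hβ
  refine hcβ.trans_le ?_
  -- By lower semicontinuity these superlevel sets are open, so compactness reduces the problem to
  -- finitely many `y`, where the weights can be found and then merged into a single `z`.
  have hcov : (Set.univ : Set X) ⊆ ⋃ y, {x | (α : ℝ≥0∞) < f x y} := fun x _ => by
    obtain ⟨y, hy⟩ := lt_iSup_iff.1 (hα.trans_le (iInf_le _ x))
    exact Set.mem_iUnion.2 ⟨y, hy⟩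
  obtain ⟨s, hs⟩ := isCompact_univ.elim_finite_subcover _
    (fun y => (hlsc y).isOpen_preimage _) hcov
  obtain ⟨p, hp1, hp⟩ := exists_weights_of_forall_exists_lt (g := fun x (y : s) => f x y)
    (fun x₁ x₂ a b hab => (hconv x₁ x₂ a b hab).imp fun x hx y => hx y)
    (ENNReal.coe_lt_coe.1 hβα) (fun x => by
      obtain ⟨y, hy, hxy⟩ := Set.mem_iUnion₂.1 (hs (Set.mem_univ x))
      exact ⟨⟨y, hy⟩, hxy⟩)
  obtain ⟨z, hz⟩ := exists_weighted_sum_le hconc Finset.univ (fun y : s => (y : Y)) p hp1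
  exact le_iSup_of_le z (le_iInf fun x => (hp x).trans (hz x))


/-! ### Compactness of the set of channels -/

/-- The principal minor on `i`, `j` is non-negative, so `‖M i j‖ ^ 2` is at most the product of two
diagonal entries, each at most the trace. -/
theorem norm_apply_le_trace_of_posSemidef {n : Type*} [Fintype n] {M : Matrix n n ℂ}
    (hM : M.PosSemidef) (i j : n) : ‖M i j‖ ≤ M.trace.re := by
  have hdiag : ∀ k, 0 ≤ (M k k).re := fun k => (Complex.le_def.1 (hM.diag_nonneg (i := k))).1
  have him : ∀ k, (M k k).im = 0 := fun k =>
    (Complex.le_def.1 (hM.diag_nonneg (i := k))).2.symm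
  have hle : ∀ k, (M k k).re ≤ M.trace.re := fun k => by
    rw [Matrix.trace, Complex.re_sum]
    exact Finset.single_le_sum (f := fun k => (M.diag k).re) (fun k _ => hdiag k)
      (Finset.mem_univ k)
  have hdet := (hM.submatrix ![i, j]).det_nonneg
  have hconj : M j i = star (M i j) := (hM.1.apply j i).symm
  rw [Matrix.det_fin_two] at hdet
  simp only [Matrix.submatrix_apply, Matrix.cons_val_zero, Matrix.cons_val_one, hconj] at hdet
  have h := (Complex.le_def.1 hdet).1
  have h2 : (M i j * star (M i j)).re = ‖M i j‖ ^ 2 := by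
    rw [Complex.star_def, Complex.mul_conj, Complex.ofReal_re, Complex.normSq_eq_norm_sq]
  rw [Complex.sub_re, h2, Complex.mul_re, him i, him j, Complex.zero_re] at h
  have h3 : ‖M i j‖ ^ 2 ≤ M.trace.re ^ 2 := by
    nlinarith [hle i, hle j, hdiag i, hdiag j]
  exact (abs_le_of_sq_le_sq' h3 ((hdiag i).trans (hle i))).2

theorem isClosed_setOf_posSemidef (n : Type*) [Fintype n] :
    IsClosed {M : Matrix n n ℂ | M.PosSemidef} := by
  simp only [Matrix.posSemidef_iff_dotProduct_mulVec, Set.ofPred_and, Set.ofPred_forall]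
  refine IsClosed.inter (isClosed_eq (by fun_prop) continuous_id) (isClosed_iInter fun x => ?_)
  exact isClosed_le continuous_const (by fun_prop)

variable {ι κ : Type} [Fintype ι] [Fintype κ]

theorem Channel.isInducing_toLin :
    Topology.IsInducing (fun (Φ : Channel ι κ) X => Φ.toLin X) := ⟨rfl⟩

theorem Channel.continuous_toLin_apply (X : Matrix ι ι ℂ) :
    Continuous fun Φ : Channel ι κ => Φ.toLin X :=
  (continuous_apply X).comp Channel.isInducing_toLin.continuous

/-- These numbers are the entries of the Choi matrix, the image under `id ⊗ Φ` of an unnormalized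
maximally entangled projector. It is positive semidefinite, and its trace does not depend on `Φ`. -/
theorem Channel.exists_norm_apply_single_le [DecidableEq ι] : ∃ C : ℝ, ∀ (Φ : Channel ι κ)
    (i j : ι) (k l : κ), ‖Φ.toLin (Matrix.single i j 1) k l‖ ≤ C := by
  set v : ι × ι → ℂ := fun x => if x.1 = x.2 then 1 else 0 with hv
  have hΩ : (Matrix.vecMulVec v (star v)).PosSemidef := Matrix.posSemidef_vecMulVec_self_star v
  refine ⟨(Matrix.vecMulVec v (star v)).trace.re, fun Φ i j k l => ?_⟩
  have h := norm_apply_le_trace_of_posSemidef (Φ.completelyPositive ι _ hΩ) (i, k) (j, l)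
  rw [show (ampliate ι Φ.toLin _).trace = _ from (Φ.tensorLeft ι).trace_map _] at h
  convert h using 2
  simp only [ampliate, LinearMap.coe_mk, AddHom.coe_mk, Matrix.of_apply]
  refine congrFun (congrFun (congrArg _ (Matrix.ext fun a b => ?_)) k) l
  simp only [Matrix.single_apply, Matrix.submatrix_apply, Matrix.vecMulVec_apply, hv, Pi.star_apply]
  by_cases h1 : i = a <;> by_cases h2 : j = b <;> simp [h1, h2]

theorem Channel.exists_norm_apply_le (X : Matrix ι ι ℂ) :
    ∃ C : ℝ, ∀ (Φ : Channel ι κ) (k l : κ), ‖Φ.toLin X k l‖ ≤ C := by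
  classical
  obtain ⟨C, hC⟩ := Channel.exists_norm_apply_single_le (ι := ι) (κ := κ)
  refine ⟨∑ i, ∑ j, ‖X i j‖ * C, fun Φ k l => ?_⟩
  conv_lhs => rw [Matrix.matrix_eq_sum_single X]
  simp only [map_sum, Matrix.sum_apply]
  refine norm_sum_le_of_le _ fun i _ => norm_sum_le_of_le _ fun j _ => ?_
  have : Matrix.single i j (X i j) = X i j • Matrix.single i j (1 : ℂ) := by simp
  rw [this, map_smul, Matrix.smul_apply, norm_smul]
  gcongr
  exact hC Φ i j k l

/-- Linearity, complete positivity and trace preservation are each an intersection of conditions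
closed under pointwise convergence. -/
theorem Channel.isClosed_range_toLin :
    IsClosed (Set.range fun (Φ : Channel ι κ) X => Φ.toLin X) := by
  have : (Set.range fun (Φ : Channel ι κ) X => Φ.toLin X) =
      {f | (∀ X Y, f (X + Y) = f X + f Y) ∧ (∀ (c : ℂ) X, f (c • X) = c • f X) ∧
        (∀ (R : Type) (_ : Fintype R) (X : Matrix (R × ι) (R × ι) ℂ), X.PosSemidef →
          (Matrix.of fun i j : R × κ =>
            f (X.submatrix (Prod.mk i.1) (Prod.mk j.1)) i.2 j.2).PosSemidef) ∧
        ∀ X, (f X).trace = X.trace} := by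
    ext f
    constructor
    · rintro ⟨Φ, rfl⟩
      exact ⟨map_add _, map_smul _, fun R _ X hX => Φ.completelyPositive R X hX, Φ.trace_map⟩
    · rintro ⟨h1, h2, h3, h4⟩
      exact ⟨⟨⟨⟨f, h1⟩, h2⟩, fun R inst X hX => h3 R inst X hX, h4⟩, rfl⟩
  rw [this]
  simp only [Set.ofPred_and, Set.ofPred_forall]
  refine IsClosed.inter ?_ (IsClosed.inter ?_ (IsClosed.inter ?_ ?_))
  · exact isClosed_iInter fun X => isClosed_iInter fun Y => isClosed_eq (by fun_prop) (by fun_prop)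
  · exact isClosed_iInter fun X => isClosed_iInter fun Y => isClosed_eq (by fun_prop) (by fun_prop)
  · refine isClosed_iInter fun R => isClosed_iInter fun _ => isClosed_iInter fun X =>
      isClosed_iInter fun _ => (isClosed_setOf_posSemidef (R × κ)).preimage ?_
    exact continuous_matrix fun i j => ((continuous_apply j.2).comp ((continuous_apply i.2).comp
      (continuous_apply (X.submatrix (Prod.mk i.1) (Prod.mk j.1)))))
  · exact isClosed_iInter fun X => isClosed_eq (by fun_prop) (by fun_prop)

instance Channel.instCompactSpace : CompactSpace (Channel ι κ) := by
  choose C hC using Channel.exists_norm_apply_le (ι := ι) (κ := κ)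
  rw [← isCompact_univ_iff, Channel.isInducing_toLin.isCompact_iff, Set.image_univ]
  refine IsCompact.of_isClosed_subset (isCompact_univ_pi fun X => isCompact_univ_pi fun _ =>
    isCompact_univ_pi fun _ => isCompact_closedBall (0 : ℂ) (C X)) Channel.isClosed_range_toLin ?_
  rintro _ ⟨Φ, rfl⟩ X _ k _ l _
  simpa using hC X Φ k l

theorem Channel.continuous_tensorLeft_apply (R : Type) [Fintype R] (ρ : State (R × ι)) :
    Continuous fun Φ : Channel ι κ => (Φ.tensorLeft R).apply ρ := by
  refine continuous_induced_rng.2 (continuous_matrix fun i j => ?_)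
  exact (continuous_apply j.2).comp ((continuous_apply i.2).comp
    (Channel.continuous_toLin_apply (ρ.mat.submatrix (Prod.mk i.1) (Prod.mk j.1))))


/-! ### Minimax for bounded convex functions without semicontinuity -/

/-- Take a relative interior point: differences of points of `C` are directions of the affine span,
in which `C` contains a ball around it. -/
theorem exists_mem_forall_add_smul_sub_mem {E : Type*} [NormedAddCommGroup E] [NormedSpace ℝ E]
    [FiniteDimensional ℝ E] {C : Set E} (hC : Convex ℝ C) (hne : C.Nonempty) :
    ∃ x₀ ∈ C, ∃ r > 0, ∀ x ∈ C, ∀ y ∈ C, ∀ t : ℝ, ‖t • (x - y)‖ < r → x₀ + t • (x - y) ∈ C := by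
  obtain ⟨x₀, hx₀⟩ := hne.intrinsicInterior hC
  obtain ⟨z, hz, rfl⟩ := mem_intrinsicInterior.1 hx₀
  obtain ⟨r, hr, hball⟩ := Metric.mem_nhds_iff.1 (mem_interior_iff_mem_nhds.1 hz)
  refine ⟨z, intrinsicInterior_subset hx₀, r, hr, fun x hx y hy t ht => ?_⟩
  have hdir : t • (x - y) ∈ (affineSpan ℝ C).direction :=
    Submodule.smul_mem _ _ (AffineSubspace.vsub_mem_direction (subset_affineSpan ℝ C hx)
      (subset_affineSpan ℝ C hy))
  have hmem : (z : E) + t • (x - y) ∈ affineSpan ℝ C := by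
    rw [add_comm]
    exact AffineSubspace.vadd_mem_of_mem_direction hdir z.2
  refine hball (a := ⟨_, hmem⟩) ?_
  rw [Metric.mem_ball, Subtype.dist_eq, dist_eq_norm]
  simpa using ht

/-- A bounded convex function becomes lower semicontinuous after contracting its domain
towards a point of the relative interior. -/
theorem exists_forall_lowerSemicontinuous_comp {X E : Type*} [TopologicalSpace X] [Nonempty X]
    [NormedAddCommGroup E] [NormedSpace ℝ E] [FiniteDimensional ℝ E] {J : X → E}
    (hJ : Continuous J) (hJc : Convex ℝ (Set.range J)) :
    ∃ x₀, ∀ (g : X → ℝ) (K : ℝ), (∀ x, g x ≤ K) →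
      (∀ x x₁ x₂ (a b : ℝ), 0 ≤ a → 0 ≤ b → a + b = 1 → J x = a • J x₁ + b • J x₂ →
        g x ≤ a * g x₁ + b * g x₂) →
      ∀ ε : ℝ, 0 < ε → ε < 1 → ∀ s : X → X, (∀ x, J (s x) = (1 - ε) • J x + ε • J x₀) →
        LowerSemicontinuous (g ∘ s) := by
  obtain ⟨_, ⟨x₀, rfl⟩, r, hr, hball⟩ :=
    exists_mem_forall_add_smul_sub_mem hJc (Set.range_nonempty J)
  refine ⟨x₀, fun g K hK hg ε hε0 hε1 s hs x c hc => ?_⟩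
  simp only [Function.comp_apply] at hc ⊢
  set G := g (s x) with hG
  -- If `g (s x') ≤ c` held near `x`, convexity would give `G ≤ (1 - δ) * c + δ * K`; `δ` is taken
  -- small enough to exclude this.
  obtain ⟨δ, hδ0, hδ1, hδ⟩ : ∃ δ : ℝ, 0 < δ ∧ δ < 1 ∧ (1 - δ) * c + δ * K < G := by
    have hpos : 0 < 2 * (|K - c| + (G - c)) := by have := abs_nonneg (K - c); linarith
    refine ⟨(G - c) / (2 * (|K - c| + (G - c))), div_pos (by linarith) hpos, ?_, ?_⟩
    · rw [div_lt_one hpos]; have := abs_nonneg (K - c); linarith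
    · have h1 : (G - c) / (2 * (|K - c| + (G - c))) * (K - c) < G - c := by
        rw [div_mul_eq_mul_div, div_lt_iff₀ hpos]
        have := le_abs_self (K - c)
        have := abs_nonneg (K - c)
        nlinarith
      linarith
  -- Chosen so that `s x` lies on the segment from `s x'` to a point `z` of the domain, with weight
  -- `δ` on `z`: with `z = (1 - ε) x + ε (x₀ + t (x - x'))` the terms in `x'` cancel. For `x'` near
  -- `x` the vector `t (x - x')` is small, so `z` stays in the domain.
  set t := (1 - δ) * (1 - ε) / (δ * ε) with ht
  have hcont : Continuous fun x' => ‖t • (J x - J x')‖ := by fun_prop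
  have hev := hcont.continuousAt.eventually_lt (continuousAt_const (y := r) (x := x))
    (by simpa using hr)
  filter_upwards [hev] with x' hx'
  obtain ⟨z₁, hz₁⟩ := hball _ ⟨x, rfl⟩ _ ⟨x', rfl⟩ t hx'
  obtain ⟨z, hz⟩ : (1 - ε) • J x + ε • J z₁ ∈ Set.range J :=
    hJc ⟨x, rfl⟩ ⟨z₁, rfl⟩ (by linarith) hε0.le (by ring)
  have hkey : J (s x) = (1 - δ) • J (s x') + δ • J z := by
    rw [hs, hs, hz, hz₁]
    have h2 : δ * (ε * t) = (1 - δ) * (1 - ε) := by rw [ht]; field_simp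
    have h3 : δ • ε • (J x₀ + t • (J x - J x')) =
        (δ * ε) • J x₀ + (δ * (ε * t)) • (J x - J x') := by module
    rw [smul_add δ, h3, h2]
    module
  have h4 := hg _ _ _ _ _ (by linarith) hδ0.le (by ring) hkey
  by_contra hcon
  push Not at hcon
  have h5 := mul_le_mul_of_nonneg_left hcon (sub_nonneg.2 hδ1.le)
  have h6 := mul_le_mul_of_nonneg_left (hK z) hδ0.le
  linarith

/-- The minimax theorem without semicontinuity, for bounded functions that are convex in the first
variable, which ranges over a finite-dimensional compact convex set. -/
theorem iInf_iSup_le_iSup_iInf_of_le {X Y E : Type*} [TopologicalSpace X] [CompactSpace X]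
    [Nonempty X] [NormedAddCommGroup E] [NormedSpace ℝ E] [FiniteDimensional ℝ E] {J : X → E}
    (hJ : Continuous J) (hJc : Convex ℝ (Set.range J)) {f : X → Y → ℝ≥0∞} {K : NNReal}
    (hK : ∀ x y, f x y ≤ K)
    (hconv : ∀ x x₁ x₂ (a b : NNReal), a + b = 1 → J x = (a : ℝ) • J x₁ + (b : ℝ) • J x₂ →
      ∀ y, f x y ≤ a * f x₁ y + b * f x₂ y)
    (hconc : ∀ y₁ y₂ (a b : NNReal), a + b = 1 → ∃ y, ∀ x, a * f x y₁ + b * f x y₂ ≤ f x y) :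
    ⨅ x, ⨆ y, f x y ≤ ⨆ y, ⨅ x, f x y := by
  obtain ⟨x₀, hx₀⟩ := exists_forall_lowerSemicontinuous_comp hJ hJc
  have hfin : ∀ x y, f x y ≠ ∞ := fun x y => ne_top_of_le_ne_top ENNReal.coe_ne_top (hK x y)
  have hex : ∀ (x₁ x₂ : X) (a b : NNReal), a + b = 1 → ∃ x, J x = (a : ℝ) • J x₁ + (b : ℝ) • J x₂ :=
    fun x₁ x₂ a b hab => hJc ⟨x₁, rfl⟩ ⟨x₂, rfl⟩ a.2 b.2 (by exact_mod_cast hab)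
  -- The semicontinuous theorem is applied to `f (s x) y`, with `s` the contraction towards `x₀`.
  -- Restricting to the image of `s` only raises the infimum on the left; on the right, convexity
  -- gives `f (s x) y ≤ f x y + ε * K`.
  have hmain : ∀ ε δ : NNReal, 0 < ε → 0 < δ → δ + ε = 1 →
      ⨅ x, ⨆ y, f x y ≤ (⨆ y, ⨅ x, f x y) + ε * K := by
    intro ε δ hε hδ hδε
    have hδε' : (δ : ℝ) + ε = 1 := by exact_mod_cast hδε
    choose s hs using fun x => hex x x₀ δ ε hδε
    have hδ1 : (δ : ℝ) = 1 - ε := by linarith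
    have hlsc : ∀ y, LowerSemicontinuous fun x => f (s x) y := by
      intro y
      have h1 := hx₀ (fun x => (f x y).toReal) K
        (fun x => by simpa using ENNReal.toReal_mono ENNReal.coe_ne_top (hK x y))
        (fun x x₁ x₂ a b ha hb hab hx => by
          lift a to NNReal using ha
          lift b to NNReal using hb
          have h2 := hconv x x₁ x₂ a b (by exact_mod_cast hab) hx y
          have h3 : (a : ℝ≥0∞) * f x₁ y ≠ ∞ := ENNReal.mul_ne_top ENNReal.coe_ne_top (hfin _ _)
          have h4 : (b : ℝ≥0∞) * f x₂ y ≠ ∞ := ENNReal.mul_ne_top ENNReal.coe_ne_top (hfin _ _)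
          have h5 := ENNReal.toReal_mono (ENNReal.add_ne_top.2 ⟨h3, h4⟩) h2
          rwa [ENNReal.toReal_add h3 h4, ENNReal.toReal_mul, ENNReal.toReal_mul,
            ENNReal.coe_toReal, ENNReal.coe_toReal] at h5)
        ε (by exact_mod_cast hε) (by have : (0 : ℝ) < δ := by exact_mod_cast hδ
                                     linarith) s (fun x => by rw [hs, hδ1])
      have h2 := ENNReal.continuous_ofReal.comp_lowerSemicontinuous h1 ENNReal.ofReal_mono
      convert h2 using 2 with x
      simp [ENNReal.ofReal_toReal (hfin (s x) y)]
    calc ⨅ x, ⨆ y, f x y ≤ ⨅ x, ⨆ y, f (s x) y := le_iInf fun x => iInf_le _ (s x)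
      _ ≤ ⨆ y, ⨅ x, f (s x) y := by
        refine iInf_iSup_le_iSup_iInf hlsc (fun x₁ x₂ a b hab => ?_) (fun y₁ y₂ a b hab => ?_)
        · obtain ⟨x, hx⟩ := hex x₁ x₂ a b hab
          refine ⟨x, hconv (s x) (s x₁) (s x₂) a b hab ?_⟩
          have hab' : (a : ℝ) + b = 1 := by exact_mod_cast hab
          rw [hs, hs, hs, hx]
          have h7 : (ε : ℝ) • J x₀ = ((a : ℝ) + b) • (ε : ℝ) • J x₀ := by rw [hab', one_smul]
          conv_lhs => rw [h7]
          module
        · exact (hconc y₁ y₂ a b hab).imp fun y hy x => hy (s x)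
      _ ≤ (⨆ y, ⨅ x, f x y) + ε * K := by
        refine iSup_le fun y => le_trans ?_ (add_le_add_left (le_iSup _ y) _)
        rw [ENNReal.iInf_add]
        refine iInf_mono fun x => (hconv (s x) x x₀ δ ε hδε (hs x) y).trans ?_
        have hδ' : (δ : ℝ≥0∞) ≤ 1 := by
          exact_mod_cast (le_add_of_nonneg_right (zero_le (a := ε))).trans_eq hδε
        exact add_le_add (mul_le_of_le_one_left' hδ') (mul_le_mul_right (hK x₀ y) _)
  refine ENNReal.le_of_forall_pos_le_add fun η hη _ => ?_
  obtain ⟨ε, hε0, hε1, hεη⟩ : ∃ ε : NNReal, 0 < ε ∧ ε < 1 ∧ ε * K ≤ η := by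
    refine ⟨min (1 / 2) (η / (K + 1)), lt_min (by norm_num) (by positivity),
      (min_le_left _ _).trans_lt (by rw [← NNReal.coe_lt_coe]; norm_num), ?_⟩
    refine (mul_le_mul_left (min_le_right _ _) K).trans ?_
    rw [div_mul_eq_mul_div]
    refine div_le_of_le_mul₀ ?_ zero_le ?_
    · positivity
    · gcongr; exact le_self_add
  refine (hmain ε (1 - ε) hε0 (tsub_pos_of_lt hε1) (tsub_add_cancel_of_le hε1.le)).trans ?_
  gcongr
  exact_mod_cast hεη


/-! ### Explicit channels: partial trace, Kraus maps, measurements -/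

/-- The point `(a, b)` of the one-dimensional standard simplex. -/
def binaryWeights (a b : NNReal) (hab : a + b = 1) : stdSimplex ℝ (Fin 2) :=
  ⟨![a, b], by intro i; fin_cases i <;> simp, by simpa using congrArg NNReal.toReal hab⟩

theorem ampliate_apply {ι κ : Type} (R : Type) (Φ : Matrix ι ι ℂ →ₗ[ℂ] Matrix κ κ ℂ)
    (X : Matrix (R × ι) (R × ι) ℂ) (i j : R × κ) :
    ampliate R Φ X i j = Φ (X.submatrix (Prod.mk i.1) (Prod.mk j.1)) i.2 j.2 := rfl

namespace Channel

/-- The partial trace over the first tensor factor, as a linear map. -/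
def traceLeftLin (Q ι : Type) [Fintype Q] : Matrix (Q × ι) (Q × ι) ℂ →ₗ[ℂ] Matrix ι ι ℂ where
  toFun X := Matrix.of fun i j => ∑ q, X (q, i) (q, j)
  map_add' X Y := by ext; simp [Finset.sum_add_distrib]
  map_smul' c X := by ext; simp [Finset.mul_sum]

theorem traceLeftLin_apply {Q ι : Type} [Fintype Q] (X : Matrix (Q × ι) (Q × ι) ℂ) (i j : ι) :
    traceLeftLin Q ι X i j = ∑ q, X (q, i) (q, j) := rfl

/-- The partial trace over the first tensor factor. -/
def traceLeft (Q ι : Type) [Fintype Q] [Fintype ι] : Channel (Q × ι) ι where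
  toLin := traceLeftLin Q ι
  completelyPositive := fun R _ X hX => by
    have h : (∑ q : Q, X.submatrix (fun i : R × ι => (i.1, (q, i.2)))
        (fun i : R × ι => (i.1, (q, i.2)))).PosSemidef :=
      Matrix.posSemidef_sum _ fun q _ => hX.submatrix _
    convert h using 1
    ext i j
    simp [ampliate_apply, traceLeftLin_apply, Matrix.sum_apply]
  trace_map X := by
    simp only [Matrix.trace, Matrix.diag_apply, Fintype.sum_prod_type, traceLeftLin_apply]
    exact Finset.sum_comm

/-- The linear map with Kraus operators `K x`. -/
def krausLin {X : Type} [Fintype X] (K : X → Matrix κ ι ℂ) :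
    Matrix ι ι ℂ →ₗ[ℂ] Matrix κ κ ℂ where
  toFun ρ := ∑ x, K x * ρ * (K x).conjTranspose
  map_add' ρ σ := by simp only [Matrix.mul_add, Matrix.add_mul, Finset.sum_add_distrib]
  map_smul' c ρ := by simp [Finset.smul_sum]

omit [Fintype κ] in
theorem krausLin_apply {X : Type} [Fintype X] (K : X → Matrix κ ι ℂ) (ρ : Matrix ι ι ℂ) :
    krausLin K ρ = ∑ x, K x * ρ * (K x).conjTranspose := rfl

/-- The channel with Kraus operators `K x`. -/
def ofKraus [DecidableEq ι] {X : Type} [Fintype X] (K : X → Matrix κ ι ℂ)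
    (hK : ∑ x, (K x).conjTranspose * K x = 1) : Channel ι κ where
  toLin := krausLin K
  completelyPositive := fun R _ ρ hρ => by
    classical
    have h : (∑ x, ((1 : Matrix R R ℂ) ⊗ₖ K x) * ρ *
        ((1 : Matrix R R ℂ) ⊗ₖ K x).conjTranspose).PosSemidef :=
      Matrix.posSemidef_sum _ fun x _ => hρ.mul_mul_conjTranspose_same _
    convert h using 1
    ext i j
    simp [ampliate_apply, krausLin_apply, Matrix.sum_apply, Matrix.mul_apply,
      Fintype.sum_prod_type, Matrix.one_apply, Matrix.conjTranspose_apply, ite_mul, mul_ite,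
      apply_ite star]
  trace_map ρ := by
    rw [krausLin_apply, Matrix.trace_sum]
    have h : ∀ x, (K x * ρ * (K x).conjTranspose).trace =
        ((K x).conjTranspose * K x * ρ).trace := fun x => Matrix.trace_mul_cycle _ _ _
    rw [Finset.sum_congr rfl fun x _ => h x, ← Matrix.trace_sum, ← Finset.sum_mul, hK, one_mul]

/-- The linear map that measures in the basis `x` and prepares the state `ρ x`. -/
def measurePrepareLin {X : Type} [Fintype X] (ρ : X → State κ) :
    Matrix X X ℂ →ₗ[ℂ] Matrix κ κ ℂ where
  toFun M := ∑ x, M x x • (ρ x).mat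
  map_add' M N := by simp [add_smul, Finset.sum_add_distrib]
  map_smul' c M := by simp [Finset.smul_sum, mul_smul]

theorem measurePrepareLin_apply {X : Type} [Fintype X] (ρ : X → State κ) (M : Matrix X X ℂ) :
    measurePrepareLin ρ M = ∑ x, M x x • (ρ x).mat := rfl

/-- The channel that measures in the basis `x` and prepares the state `ρ x`. -/
def measurePrepare {X : Type} [Fintype X] (ρ : X → State κ) : Channel X κ where
  toLin := measurePrepareLin ρ
  completelyPositive := fun R _ M hM => by
    have h : (∑ x, M.submatrix (fun r : R => (r, x)) (fun r : R => (r, x)) ⊗ₖ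
        (ρ x).mat).PosSemidef :=
      Matrix.posSemidef_sum _ fun x _ => (hM.submatrix _).kronecker (ρ x).posSemidef
    convert h using 1
    ext i j
    simp [ampliate_apply, measurePrepareLin_apply, Matrix.sum_apply]
  trace_map M := by
    rw [measurePrepareLin_apply, Matrix.trace_sum]
    simp only [Matrix.trace_smul, (ρ _).trace_eq_one, smul_eq_mul, mul_one]
    rfl

theorem relabel_apply_mat (e : ι ≃ κ) (ρ : State ι) :
    ((relabel e).apply ρ).mat = ρ.mat.submatrix e.symm e.symm := rfl

theorem tensorRight_apply_mat (R : Type) [Fintype R] (Φ : Channel ι κ) (ρ : State (ι × R))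
    (i j : κ × R) : ((Φ.tensorRight R).apply ρ).mat i j =
      Φ.toLin (ρ.mat.submatrix (fun k => (k, i.2)) (fun k => (k, j.2))) i.1 j.1 := rfl

theorem tensorLeft_apply_mat (R : Type) [Fintype R] (Φ : Channel ι κ) (ρ : State (R × ι))
    (i j : R × κ) : ((Φ.tensorLeft R).apply ρ).mat i j =
      Φ.toLin (ρ.mat.submatrix (Prod.mk i.1) (Prod.mk j.1)) i.2 j.2 := rfl

/-- Reads a flag into a classical bit: the test for `ψ` leaves `ψ` fixed, and `φ`, being orthogonal
to it, always gives the other outcome. -/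
theorem exists_measure {Q : Type} [Fintype Q] (ψ φ : Q → ℂ) (hψ : star ψ ⬝ᵥ ψ = 1)
    (hφ : star φ ⬝ᵥ φ = 1) (hψφ : star ψ ⬝ᵥ φ = 0) : ∃ Φ : Channel Q (Fin 2),
      Φ.toLin (Matrix.vecMulVec ψ (star ψ)) = Matrix.single 0 0 1 ∧
      Φ.toLin (Matrix.vecMulVec φ (star φ)) = Matrix.single 1 1 1 := by
  classical
  set P : Fin 2 → Matrix Q Q ℂ :=
    ![Matrix.vecMulVec ψ (star ψ), 1 - Matrix.vecMulVec ψ (star ψ)] with hP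
  have hsq : Matrix.vecMulVec ψ (star ψ) * Matrix.vecMulVec ψ (star ψ) =
      Matrix.vecMulVec ψ (star ψ) := by
    rw [Matrix.vecMulVec_mul_vecMulVec, hψ, one_smul]
  have hH : (Matrix.vecMulVec ψ (star ψ)).conjTranspose = Matrix.vecMulVec ψ (star ψ) :=
    (Matrix.posSemidef_vecMulVec_self_star ψ).1
  have hPP : ∑ b, (P b).conjTranspose * P b = 1 := by
    rw [Fin.sum_univ_two]
    simp only [hP, Matrix.cons_val_zero, Matrix.cons_val_one, Matrix.conjTranspose_sub, hH,
      Matrix.conjTranspose_one, hsq, mul_sub, sub_mul, one_mul, mul_one]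
    abel
  -- The Kraus operator of index `(b, q)` is `|b⟩⟨q| P b`: measure, record the outcome, trace out
  -- the rest.
  have hK : ∑ x : Fin 2 × Q, (Matrix.of fun (b : Fin 2) (q : Q) =>
      if b = x.1 then P x.1 x.2 q else 0).conjTranspose * (Matrix.of fun (b : Fin 2) (q : Q) =>
      if b = x.1 then P x.1 x.2 q else 0) = 1 := by
    rw [← hPP]
    ext q q'
    simp [Matrix.sum_apply, Fintype.sum_prod_type, Matrix.mul_apply]
  have hval : ∀ v : Q → ℂ, (ofKraus _ hK).toLin (Matrix.vecMulVec v (star v)) =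
      Matrix.of fun b b' => if b = b' then star ((P b).mulVec v) ⬝ᵥ (P b).mulVec v else 0 := by
    intro v
    have hentry : ∀ (b b' : Fin 2), (ofKraus _ hK).toLin (Matrix.vecMulVec v (star v)) b b' =
      ∑ x : Fin 2 × Q, (if b = x.1 then (P x.1).mulVec v x.2 else 0) *
        star (if b' = x.1 then (P x.1).mulVec v x.2 else 0) := by
      intro b b'
      simp only [ofKraus, krausLin_apply, Matrix.sum_apply]
      refine Finset.sum_congr rfl fun x _ => ?_
      rw [Matrix.mul_vecMulVec, Matrix.vecMulVec_mul, Matrix.vecMulVec_apply]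
      rw [← Matrix.star_mulVec, Pi.star_apply]
      congr 1
      · simp only [Matrix.mulVec, dotProduct, Matrix.of_apply]
        split_ifs <;> simp
      · simp only [Matrix.mulVec, dotProduct, Matrix.of_apply]
        split_ifs <;> simp
    ext b b'
    rw [hentry, Fintype.sum_prod_type, Matrix.of_apply]
    by_cases hbb : b = b'
    · subst hbb
      rw [Finset.sum_eq_single b (by intro c _ hc; simp [hc.symm]) (by simp)]
      simp [dotProduct, mul_comm]
    · rw [if_neg hbb]
      refine Finset.sum_eq_zero fun c _ => Finset.sum_eq_zero fun q _ => ?_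
      by_cases h1 : b = c
      · rw [if_neg (fun h2 : b' = c => hbb (h1.trans h2.symm))]; simp
      · simp [h1]
  have e1 : (P 0).mulVec ψ = ψ := by
    simp [hP, Matrix.vecMulVec_mulVec, hψ]
  have e2 : (P 1).mulVec ψ = 0 := by
    simp [hP, Matrix.sub_mulVec, Matrix.vecMulVec_mulVec, hψ]
  have e3 : (P 0).mulVec φ = 0 := by
    simp [hP, Matrix.vecMulVec_mulVec, hψφ]
  have e4 : (P 1).mulVec φ = φ := by
    simp [hP, Matrix.sub_mulVec, Matrix.vecMulVec_mulVec, hψφ]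
  refine ⟨ofKraus _ hK, ?_, ?_⟩
  · rw [hval]
    ext b b'
    fin_cases b <;> fin_cases b' <;> simp [e1, e2, hψ]
  · rw [hval]
    ext b b'
    fin_cases b <;> fin_cases b' <;> simp [e3, e4, hφ]

end Channel

/-! ### What the minimax argument needs from a divergence -/

namespace StateFunction

/-- Compatibility with relabelling, with appending a fixed state, and with mixtures that are
flagged by orthonormal pure states. -/
structure IsAncillaStable (d : StateFunction) : Prop where
  relabel : ∀ {ι κ : Type} [Fintype ι] [Fintype κ] (e : ι ≃ κ) (ρ σ : State κ) (ρ' σ' : State ι),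
    ρ'.mat = ρ.mat.submatrix e e → σ'.mat = σ.mat.submatrix e e → d ι ρ' σ' ≤ d κ ρ σ
  pad : ∀ {Q ι : Type} [Fintype Q] [Fintype ι] (τ : State Q) (ρ σ : State ι)
    (ω ω' : State (Q × ι)), ω.mat = τ.mat ⊗ₖ ρ.mat → ω'.mat = τ.mat ⊗ₖ σ.mat →
      d ι ρ σ ≤ d (Q × ι) ω ω'
  flag : ∀ {Q ι : Type} [Fintype Q] [Fintype ι] (ψ φ : Q → ℂ), star ψ ⬝ᵥ ψ = 1 →
    star φ ⬝ᵥ φ = 1 → star ψ ⬝ᵥ φ = 0 → ∀ (a b : NNReal), a + b = 1 →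
    ∀ (ρ₁ σ₁ ρ₂ σ₂ : State ι) (ω ω' : State (Q × ι)),
      ω.mat = ((a : ℝ) : ℂ) • (Matrix.vecMulVec ψ (star ψ) ⊗ₖ ρ₁.mat) +
        ((b : ℝ) : ℂ) • (Matrix.vecMulVec φ (star φ) ⊗ₖ ρ₂.mat) →
      ω'.mat = ((a : ℝ) : ℂ) • (Matrix.vecMulVec ψ (star ψ) ⊗ₖ σ₁.mat) +
        ((b : ℝ) : ℂ) • (Matrix.vecMulVec φ (star φ) ⊗ₖ σ₂.mat) →
      (a : ℝ≥0∞) * d ι ρ₁ σ₁ + b * d ι ρ₂ σ₂ ≤ d (Q × ι) ω ω'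

variable {d : StateFunction}

theorem IsContractive.relabel (hd : d.IsContractive) {ι κ : Type} [Fintype ι] [Fintype κ]
    (e : ι ≃ κ) (ρ σ : State κ) (ρ' σ' : State ι) (hρ : ρ'.mat = ρ.mat.submatrix e e)
    (hσ : σ'.mat = σ.mat.submatrix e e) : d ι ρ' σ' ≤ d κ ρ σ := by
  have h1 : ρ' = (Channel.relabel e.symm).apply ρ := State.ext hρ
  have h2 : σ' = (Channel.relabel e.symm).apply σ := State.ext hσ
  rw [h1, h2]
  exact hd _ _ _ _ _

/-- A pad is removed by the partial trace. Orthonormal flags are turned by a measurement into basis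
flags, to which flag concavity applies. -/
theorem IsContractive.isAncillaStable (hd : d.IsContractive) (hf : d.IsFlagConcave) :
    d.IsAncillaStable where
  relabel := hd.relabel
  pad := by
    intro Q ι _ _ τ ρ σ ω ω' h1 h2
    have key : ∀ (ρ : State ι) (ω : State (Q × ι)), ω.mat = τ.mat ⊗ₖ ρ.mat →
        (Channel.traceLeft Q ι).apply ω = ρ := by
      intro ρ ω h
      refine State.ext (Matrix.ext fun i j => ?_)
      have : ∑ q, τ.mat q q = 1 := τ.trace_eq_one
      simp [Channel.apply, Channel.traceLeft, Channel.traceLeftLin_apply, h, ← Finset.sum_mul, this]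
    rw [← key ρ ω h1, ← key σ ω' h2]
    exact hd _ _ _ _ _
  flag := by
    intro Q ι _ _ ψ φ hψ hφ hψφ a b hab ρ₁ σ₁ ρ₂ σ₂ ω ω' h1 h2
    obtain ⟨Φ, hΦ1, hΦ2⟩ := Channel.exists_measure ψ φ hψ hφ hψφ
    have key : ∀ (ρ₁ ρ₂ : State ι) (ω : State (Q × ι)),
        ω.mat = ((a : ℝ) : ℂ) • (Matrix.vecMulVec ψ (star ψ) ⊗ₖ ρ₁.mat) +
          ((b : ℝ) : ℂ) • (Matrix.vecMulVec φ (star φ) ⊗ₖ ρ₂.mat) →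
        (State.flag (binaryWeights a b hab) ![ρ₁, ρ₂]).mat =
          ((Φ.tensorRight ι).apply ω).mat.submatrix (Equiv.prodComm ι (Fin 2))
            (Equiv.prodComm ι (Fin 2)) := by
      intro ρ₁ ρ₂ ω h
      ext ⟨i, x⟩ ⟨j, y⟩
      have hblock : ω.mat.submatrix (fun k => (k, i)) (fun k => (k, j)) =
          (((a : ℝ) : ℂ) * ρ₁.mat i j) • Matrix.vecMulVec ψ (star ψ) +
            (((b : ℝ) : ℂ) * ρ₂.mat i j) • Matrix.vecMulVec φ (star φ) := by
        ext k l
        simp only [h, Matrix.submatrix_apply, Matrix.add_apply, Matrix.smul_apply,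
          Matrix.kronecker_apply, smul_eq_mul]
        ring
      rw [Matrix.submatrix_apply, Channel.tensorRight_apply_mat]
      simp only [Equiv.prodComm_apply, Prod.swap_prod_mk]
      rw [hblock, map_add, map_smul, map_smul, hΦ1, hΦ2]
      simp [State.flag, binaryWeights, Fin.sum_univ_two, Matrix.single_apply]
    have e1 := hf ι (Fin 2) (binaryWeights a b hab) ![ρ₁, ρ₂] ![σ₁, σ₂]
    have e2 : ∑ x, ENNReal.ofReal ((binaryWeights a b hab).1 x) *
        d ι (![ρ₁, ρ₂] x) (![σ₁, σ₂] x) = (a : ℝ≥0∞) * d ι ρ₁ σ₁ + b * d ι ρ₂ σ₂ := by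
      simp [binaryWeights, Fin.sum_univ_two]
    rw [e2] at e1
    exact e1.trans ((hd.relabel _ _ _ _ _ (key ρ₁ ρ₂ ω h1) (key σ₁ σ₂ ω' h2)).trans
      (hd _ _ _ _ _))

/-- Every pair of states is the image of one fixed pair of orthogonal states under a
measure-and-prepare channel, so the value at that pair bounds all others. -/
theorem IsContractive.exists_forall_le (hd : d.IsContractive) (hfin : d.IsFinite) :
    ∃ K : NNReal, ∀ (ι : Type) [Fintype ι] (ρ σ : State ι), d ι ρ σ ≤ K := by
  set e : Fin 2 → State (Fin 2) := fun x =>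
    ⟨Matrix.diagonal (Pi.single x 1), Matrix.PosSemidef.diagonal (Pi.single_nonneg.2 zero_le_one),
      by simp [Matrix.trace_diagonal]⟩ with he
  refine ⟨(d (Fin 2) (e 0) (e 1)).toNNReal, fun ι _ ρ σ => ?_⟩
  rw [ENNReal.coe_toNNReal (hfin _ _ _)]
  have key : ∀ x, (Channel.measurePrepare ![ρ, σ]).apply (e x) = ![ρ, σ] x := by
    intro x
    refine State.ext ?_
    simp only [Channel.apply, Channel.measurePrepare, he, Channel.measurePrepareLin_apply,
      Matrix.diagonal_apply_eq]
    fin_cases x <;> simp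
  have := hd _ _ (Channel.measurePrepare ![ρ, σ]) (e 0) (e 1)
  rwa [key, key] at this

theorem IsConvexSnd.binary (hd : d.IsConvexSnd) {ι : Type} [Fintype ι] (ρ σ₁ σ₂ τ : State ι)
    {a b : NNReal} (hab : a + b = 1)
    (hτ : τ.mat = ((a : ℝ) : ℂ) • σ₁.mat + ((b : ℝ) : ℂ) • σ₂.mat) :
    d ι ρ τ ≤ a * d ι ρ σ₁ + b * d ι ρ σ₂ := by
  have h := hd ι (Fin 2) (binaryWeights a b hab) ρ ![σ₁, σ₂]
  have h1 : State.mix (binaryWeights a b hab) ![σ₁, σ₂] = τ := by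
    refine State.ext ?_
    simp [State.mix, binaryWeights, Fin.sum_univ_two, hτ]
  rw [h1] at h
  refine h.trans_eq ?_
  simp [binaryWeights, Fin.sum_univ_two]

end StateFunction

/-! ### Concave-likeness in the test state, and the minimax identity for channels -/

/-- The product of two states. -/
def State.prod {Q ι : Type} [Fintype Q] [Fintype ι] (τ : State Q) (ρ : State ι) :
    State (Q × ι) where
  mat := τ.mat ⊗ₖ ρ.mat
  posSemidef := τ.posSemidef.kronecker ρ.posSemidef
  trace_eq_one := by rw [Matrix.trace_kronecker, τ.trace_eq_one, ρ.trace_eq_one, one_mul]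

theorem Channel.smul_add_smul_toLin_apply {ι κ : Type} [Fintype ι] [Fintype κ]
    {M M₁ M₂ : Channel ι κ} {a b : ℝ} (h : M.toLin = a • M₁.toLin + b • M₂.toLin)
    (X : Matrix ι ι ℂ) (k l : κ) :
    M.toLin X k l = (a : ℂ) * M₁.toLin X k l + (b : ℂ) * M₂.toLin X k l := by
  rw [h]
  simp

/-- The mixture `ω` does not depend on the channels, which act only on `α` and so commute with flags
and pads. Each branch carries the other's ancilla state, `τ₂` or `τ₁`, so that both have the ancilla
`R₂ × R₁`. -/
theorem StateFunction.IsAncillaStable.add_le {d : StateFunction} (hd : d.IsAncillaStable)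
    {Q R₁ R₂ α β : Type} [Fintype Q] [Fintype R₁] [Fintype R₂] [Fintype α] [Fintype β]
    {ψ φ : Q → ℂ} (hψ : star ψ ⬝ᵥ ψ = 1) (hφ : star φ ⬝ᵥ φ = 1) (hψφ : star ψ ⬝ᵥ φ = 0)
    (τ₁ : State R₁) (τ₂ : State R₂) (ρ₁ : State (R₁ × α)) (ρ₂ : State (R₂ × α))
    {a b : NNReal} (hab : a + b = 1) (ω : State ((Q × (R₂ × R₁)) × α))
    (hω : ∀ q s r i q' s' r' j, ω.mat ((q, (s, r)), i) ((q', (s', r')), j) =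
      ((a : ℝ) : ℂ) * (ψ q * star (ψ q')) * (τ₂.mat s s' * ρ₁.mat (r, i) (r', j)) +
      ((b : ℝ) : ℂ) * (φ q * star (φ q')) * (τ₁.mat r r' * ρ₂.mat (s, i) (s', j)))
    (N M : Channel α β) :
    (a : ℝ≥0∞) * d (R₁ × β) ((N.tensorLeft R₁).apply ρ₁) ((M.tensorLeft R₁).apply ρ₁) +
      b * d (R₂ × β) ((N.tensorLeft R₂).apply ρ₂) ((M.tensorLeft R₂).apply ρ₂) ≤
      d ((Q × (R₂ × R₁)) × β) ((N.tensorLeft _).apply ω) ((M.tensorLeft _).apply ω) := by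
  let e₁ : R₂ × (R₁ × β) ≃ (R₂ × R₁) × β := (Equiv.prodAssoc R₂ R₁ β).symm
  let e₂ : R₁ × (R₂ × β) ≃ (R₂ × R₁) × β :=
    ⟨fun x => ((x.2.1, x.1), x.2.2), fun x => (x.1.2, (x.1.1, x.2)), fun _ => rfl, fun _ => rfl⟩
  let e : (Q × (R₂ × R₁)) × β ≃ Q × ((R₂ × R₁) × β) := Equiv.prodAssoc _ _ _
  let θ₁ : Channel α β → State (R₂ × (R₁ × β)) := fun M => τ₂.prod ((M.tensorLeft R₁).apply ρ₁)
  let θ₂ : Channel α β → State (R₁ × (R₂ × β)) := fun M => τ₁.prod ((M.tensorLeft R₂).apply ρ₂)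
  let η₁ : Channel α β → State ((R₂ × R₁) × β) := fun M => (Channel.relabel e₁).apply (θ₁ M)
  let η₂ : Channel α β → State ((R₂ × R₁) × β) := fun M => (Channel.relabel e₂).apply (θ₂ M)
  let Ω : Channel α β → State (Q × ((R₂ × R₁) × β)) :=
    fun M => (Channel.relabel e).apply ((M.tensorLeft _).apply ω)
  have hΩ : ∀ M, (Ω M).mat = ((a : ℝ) : ℂ) • (Matrix.vecMulVec ψ (star ψ) ⊗ₖ (η₁ M).mat) +
      ((b : ℝ) : ℂ) • (Matrix.vecMulVec φ (star φ) ⊗ₖ (η₂ M).mat) := by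
    intro M
    ext ⟨q, ⟨s, r⟩, k⟩ ⟨q', ⟨s', r'⟩, l⟩
    have hblock : ω.mat.submatrix (Prod.mk (q, (s, r))) (Prod.mk (q', (s', r'))) =
        (((a : ℝ) : ℂ) * (ψ q * star (ψ q')) * τ₂.mat s s') •
          ρ₁.mat.submatrix (Prod.mk r) (Prod.mk r') +
        (((b : ℝ) : ℂ) * (φ q * star (φ q')) * τ₁.mat r r') •
          ρ₂.mat.submatrix (Prod.mk s) (Prod.mk s') := by
      ext i j
      simp only [hω, Matrix.submatrix_apply, Matrix.add_apply, Matrix.smul_apply, smul_eq_mul,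
        mul_assoc]
    have h1 : (Ω M).mat (q, (s, r), k) (q', (s', r'), l) =
        M.toLin (ω.mat.submatrix (Prod.mk (q, (s, r))) (Prod.mk (q', (s', r')))) k l := rfl
    have h2 : (η₁ M).mat ((s, r), k) ((s', r'), l) =
        τ₂.mat s s' * M.toLin (ρ₁.mat.submatrix (Prod.mk r) (Prod.mk r')) k l := rfl
    have h3 : (η₂ M).mat ((s, r), k) ((s', r'), l) =
        τ₁.mat r r' * M.toLin (ρ₂.mat.submatrix (Prod.mk s) (Prod.mk s')) k l := rfl
    rw [h1, hblock, map_add, map_smul, map_smul]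
    simp only [Matrix.add_apply, Matrix.smul_apply, Matrix.kronecker_apply, h2, h3, smul_eq_mul,
      Matrix.vecMulVec_apply, Pi.star_apply]
    ring
  have i₁ : d (R₁ × β) ((N.tensorLeft R₁).apply ρ₁) ((M.tensorLeft R₁).apply ρ₁) ≤
      d _ (η₁ N) (η₁ M) :=
    (hd.pad τ₂ _ _ (θ₁ N) (θ₁ M) rfl rfl).trans (hd.relabel e₁ _ _ _ _ rfl rfl)
  have i₂ : d (R₂ × β) ((N.tensorLeft R₂).apply ρ₂) ((M.tensorLeft R₂).apply ρ₂) ≤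
      d _ (η₂ N) (η₂ M) :=
    (hd.pad τ₁ _ _ (θ₂ N) (θ₂ M) rfl rfl).trans (hd.relabel e₂ _ _ _ _ rfl rfl)
  calc _ ≤ (a : ℝ≥0∞) * d _ (η₁ N) (η₁ M) + b * d _ (η₂ N) (η₂ M) := by gcongr
    _ ≤ d _ (Ω N) (Ω M) := hd.flag ψ φ hψ hφ hψφ a b hab _ _ _ _ _ _ (hΩ N) (hΩ M)
    _ ≤ _ := hd.relabel e.symm _ _ _ _ rfl rfl

/-- The minimax identity for the free channels and any family of test states that is closed under
flagged mixtures. -/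
theorem ResourceTheory.iInf_iSup_eq_iSup_iInf {S : Type*} {dim : S → ℕ+} (F : ResourceTheory dim)
    (A B : PhysSystem S) (N : Channel (A.Idx dim) (B.Idx dim)) (hconv : F.ConvexChannels A B)
    (hne : (F.free A B).Nonempty) {d : StateFunction} (hsnd : d.IsConvexSnd)
    (hd : (∃ K : NNReal, ∀ (ι : Type) [Fintype ι] (ρ σ : State ι), d ι ρ σ ≤ K) ∨ d.IsLscSnd)
    {Y : Type*} (R : Y → Type) [∀ y, Fintype (R y)] (ρ : ∀ y, State (R y × A.Idx dim))
    (hconc : ∀ y₁ y₂ (a b : NNReal), a + b = 1 → ∃ y, ∀ M : Channel (A.Idx dim) (B.Idx dim),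
      (a : ℝ≥0∞) * d _ ((N.tensorLeft (R y₁)).apply (ρ y₁)) ((M.tensorLeft (R y₁)).apply (ρ y₁)) +
        b * d _ ((N.tensorLeft (R y₂)).apply (ρ y₂)) ((M.tensorLeft (R y₂)).apply (ρ y₂)) ≤
        d _ ((N.tensorLeft (R y)).apply (ρ y)) ((M.tensorLeft (R y)).apply (ρ y))) :
    ⨅ M ∈ F.free A B, ⨆ y,
        d _ ((N.tensorLeft (R y)).apply (ρ y)) ((M.tensorLeft (R y)).apply (ρ y)) =
      ⨆ y, ⨅ M ∈ F.free A B,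
        d _ ((N.tensorLeft (R y)).apply (ρ y)) ((M.tensorLeft (R y)).apply (ρ y)) := by
  classical
  simp only [iInf_subtype']
  refine le_antisymm ?_ (iSup_iInf_le_iInf_iSup _)
  have : Nonempty (F.free A B) := hne.to_subtype
  have : CompactSpace (F.free A B) :=
    isCompact_iff_compactSpace.1 (F.isClosed_free A B).isCompact
  have hmix : ∀ (M M₁ M₂ : Channel (A.Idx dim) (B.Idx dim)) (a b : NNReal), a + b = 1 →
      M.toLin = (a : ℝ) • M₁.toLin + (b : ℝ) • M₂.toLin → ∀ y,
      d _ ((N.tensorLeft (R y)).apply (ρ y)) ((M.tensorLeft (R y)).apply (ρ y)) ≤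
      (a : ℝ≥0∞) * d _ ((N.tensorLeft (R y)).apply (ρ y)) ((M₁.tensorLeft (R y)).apply (ρ y)) +
        b * d _ ((N.tensorLeft (R y)).apply (ρ y)) ((M₂.tensorLeft (R y)).apply (ρ y)) := by
    intro M M₁ M₂ a b hab h y
    refine hsnd.binary _ _ _ _ hab (Matrix.ext fun i j => ?_)
    simp only [Matrix.add_apply, Matrix.smul_apply, smul_eq_mul, Channel.tensorLeft_apply_mat]
    exact Channel.smul_add_smul_toLin_apply h _ _ _
  have hex : ∀ (M₁ M₂ : F.free A B) (a b : NNReal), a + b = 1 →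
      ∃ M : F.free A B, M.1.toLin = (a : ℝ) • M₁.1.toLin + (b : ℝ) • M₂.1.toLin := by
    intro M₁ M₂ a b hab
    obtain ⟨M, hM, h⟩ := hconv ⟨_, M₁.2, rfl⟩ ⟨_, M₂.2, rfl⟩ a.2 b.2
      (congrArg NNReal.toReal hab)
    exact ⟨⟨M, hM⟩, h⟩
  have hconc' : ∀ y₁ y₂ (a b : NNReal), a + b = 1 → ∃ y, ∀ M : F.free A B,
      (a : ℝ≥0∞) * d _ ((N.tensorLeft (R y₁)).apply (ρ y₁))
          ((M.1.tensorLeft (R y₁)).apply (ρ y₁)) +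
        b * d _ ((N.tensorLeft (R y₂)).apply (ρ y₂)) ((M.1.tensorLeft (R y₂)).apply (ρ y₂)) ≤
        d _ ((N.tensorLeft (R y)).apply (ρ y)) ((M.1.tensorLeft (R y)).apply (ρ y)) :=
    fun y₁ y₂ a b hab => (hconc y₁ y₂ a b hab).imp fun y hy M => hy M.1
  rcases hd with ⟨K, hK⟩ | hlsc
  -- The images of the matrix units are coordinates that determine a channel and embed the free
  -- channels affinely in a finite-dimensional space.
  · set J : F.free A B → (A.Idx dim → A.Idx dim → B.Idx dim → B.Idx dim → ℂ) :=
      fun M i j k l => M.1.toLin (Matrix.single i j 1) k l with hJ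
    have hJcont : Continuous J := by
      refine continuous_pi fun i => continuous_pi fun j => continuous_pi fun k =>
        continuous_pi fun l => ?_
      exact (continuous_apply l).comp ((continuous_apply k).comp
        ((Channel.continuous_toLin_apply (Matrix.single i j 1)).comp continuous_subtype_val))
    refine iInf_iSup_le_iSup_iInf_of_le hJcont ?_ (K := K) (fun M y => hK _ _ _) ?_ hconc'
    · rintro _ ⟨M₁, rfl⟩ _ ⟨M₂, rfl⟩ a b ha hb hab
      lift a to NNReal using ha
      lift b to NNReal using hb
      obtain ⟨M, hM⟩ := hex M₁ M₂ a b (by exact_mod_cast hab)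
      refine ⟨M, ?_⟩
      ext i j k l
      simpa [hJ] using Channel.smul_add_smul_toLin_apply hM (Matrix.single i j 1) k l
    · intro M M₁ M₂ a b hab h
      refine hmix _ _ _ a b hab (Matrix.ext_linearMap ℂ fun i j => ?_)
      ext k l
      have := congrFun (congrFun (congrFun (congrFun h i) j) k) l
      simpa [hJ] using this
  · refine iInf_iSup_le_iSup_iInf (fun y => ?_) (fun M₁ M₂ a b hab => ?_) hconc'
    · exact (hlsc _ _).comp
        ((Channel.continuous_tensorLeft_apply (R y) (ρ y)).comp continuous_subtype_val)
    · obtain ⟨M, hM⟩ := hex M₁ M₂ a b hab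
      exact ⟨M, hmix _ _ _ a b hab hM⟩


/-! ### The two families of test states: all states and free states -/

/-- The pure state of a unit vector. -/
def State.pure {ι : Type} [Fintype ι] (ψ : ι → ℂ) (hψ : star ψ ⬝ᵥ ψ = 1) : State ι where
  mat := Matrix.vecMulVec ψ (star ψ)
  posSemidef := Matrix.posSemidef_vecMulVec_self_star ψ
  trace_eq_one := by rw [Matrix.trace_vecMulVec, dotProduct_comm, hψ]

theorem State.nonempty_of_state {ι : Type} [Fintype ι] (ρ : State ι) : Nonempty ι := by
  by_contra h
  rw [not_nonempty_iff] at h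
  have := ρ.trace_eq_one
  simp [Matrix.trace] at this

theorem State.nonempty (ι : Type) [Fintype ι] [Nonempty ι] : Nonempty (State ι) := by
  classical
  exact ⟨State.pure (Pi.single (Classical.arbitrary ι) 1) (by simp)⟩

namespace ResourceTheory

variable {S : Type*} {dim : S → ℕ+} (F : ResourceTheory dim) (A B : PhysSystem S)

theorem idx_nonempty {S : Type*} (dim : S → ℕ+) : ∀ A : PhysSystem S, Nonempty (A.Idx dim)
  | .trivial => inferInstanceAs (Nonempty Unit)
  | .elem s => ⟨(⟨0, (dim s).pos⟩ : Fin (dim s))⟩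
  | .tensor A B =>
    let ⟨a⟩ := idx_nonempty dim A
    let ⟨b⟩ := idx_nonempty dim B
    ⟨((a, b) : A.Idx dim × B.Idx dim)⟩

theorem exists_flagged_mixture {Q R₁ R₂ α : Type} [Fintype Q] [Fintype R₁] [Fintype R₂]
    [Fintype α] {ψ φ : Q → ℂ} (hψ : star ψ ⬝ᵥ ψ = 1) (hφ : star φ ⬝ᵥ φ = 1)
    (τ₁ : State R₁) (τ₂ : State R₂) (ρ₁ : State (R₁ × α)) (ρ₂ : State (R₂ × α))
    {a b : NNReal} (hab : a + b = 1) : ∃ ω : State ((Q × (R₂ × R₁)) × α),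
    ∀ q s r i q' s' r' j, ω.mat ((q, (s, r)), i) ((q', (s', r')), j) =
      ((a : ℝ) : ℂ) * (ψ q * star (ψ q')) * (τ₂.mat s s' * ρ₁.mat (r, i) (r', j)) +
      ((b : ℝ) : ℂ) * (φ q * star (φ q')) * (τ₁.mat r r' * ρ₂.mat (s, i) (s', j)) := by
  let e₁ : Q × (R₂ × (R₁ × α)) ≃ (Q × (R₂ × R₁)) × α :=
    ⟨fun x => ((x.1, (x.2.1, x.2.2.1)), x.2.2.2), fun x => (x.1.1, x.1.2.1, x.1.2.2, x.2),
      fun _ => rfl, fun _ => rfl⟩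
  let e₂ : Q × (R₁ × (R₂ × α)) ≃ (Q × (R₂ × R₁)) × α :=
    ⟨fun x => ((x.1, (x.2.2.1, x.2.1)), x.2.2.2), fun x => (x.1.1, x.1.2.2, x.1.2.1, x.2),
      fun _ => rfl, fun _ => rfl⟩
  refine ⟨State.mix (binaryWeights a b hab)
    ![(Channel.relabel e₁).apply ((State.pure ψ hψ).prod (τ₂.prod ρ₁)),
      (Channel.relabel e₂).apply ((State.pure φ hφ).prod (τ₁.prod ρ₂))], ?_⟩
  intro q s r i q' s' r' j
  simp [State.mix, binaryWeights, Fin.sum_univ_two, Channel.relabel_apply_mat, State.prod,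
    State.pure, Matrix.vecMulVec_apply, e₁, e₂, mul_assoc]

theorem infSupAll_eq_supInfAll (N : Channel (A.Idx dim) (B.Idx dim))
    (hconv : F.ConvexChannels A B) {d : StateFunction} (hst : d.IsAncillaStable)
    (hsnd : d.IsConvexSnd)
    (hd : (∃ K : NNReal, ∀ (ι : Type) [Fintype ι] (ρ σ : State ι), d ι ρ σ ≤ K) ∨ d.IsLscSnd) :
    F.infSupAll A B d N = F.supInfAll A B d N := by
  rcases (F.free A B).eq_empty_or_nonempty with hemp | hne
  -- An infimum over no channels is `∞`, so the right-hand side agrees as soon as one test state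
  -- exists; systems have positive dimension.
  · have : Nonempty (A.Idx dim) := idx_nonempty dim A
    obtain ⟨ρ⟩ := State.nonempty (Fin 1 × A.Idx dim)
    rw [infSupAll, supInfAll]
    simp only [hemp, Set.mem_empty_iff_false, iInf_false, iInf_top]
    refine (top_le_iff.1 ?_).symm
    exact le_iSup_of_le (1 : ℕ) (le_iSup (fun _ : State (Fin 1 × A.Idx dim) => (⊤ : ℝ≥0∞)) ρ)
  have key := F.iInf_iSup_eq_iSup_iInf A B N hconv hne hsnd hd
    (Y := Σ r : ℕ, State (Fin r × A.Idx dim)) (fun y => Fin y.1) (fun y => y.2) ?_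
  · simpa only [infSupAll, supInfAll, iSup_sigma] using key
  rintro ⟨r₁, ρ₁⟩ ⟨r₂, ρ₂⟩ a b hab
  have : Nonempty (Fin r₁) := ⟨(State.nonempty_of_state ρ₁).some.1⟩
  have : Nonempty (Fin r₂) := ⟨(State.nonempty_of_state ρ₂).some.1⟩
  obtain ⟨τ₁⟩ := State.nonempty (Fin r₁)
  obtain ⟨τ₂⟩ := State.nonempty (Fin r₂)
  have hψ : star (Pi.single 0 1 : Fin 2 → ℂ) ⬝ᵥ Pi.single 0 1 = 1 := by simp
  have hφ : star (Pi.single 1 1 : Fin 2 → ℂ) ⬝ᵥ Pi.single 1 1 = 1 := by simp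
  have hψφ : star (Pi.single 0 1 : Fin 2 → ℂ) ⬝ᵥ Pi.single 1 1 = 0 := by simp
  obtain ⟨ω, hω⟩ := exists_flagged_mixture hψ hφ τ₁ τ₂ ρ₁ ρ₂ hab
  -- The supremum runs over ancillas `Fin r`, so the composite ancilla is renumbered.
  let e := Fintype.equivFin (Fin 2 × (Fin r₂ × Fin r₁))
  refine ⟨⟨_, (Channel.relabel (e.prodCongr (Equiv.refl _))).apply ω⟩, fun M => ?_⟩
  refine (hst.add_le hψ hφ hψφ τ₁ τ₂ ρ₁ ρ₂ hab ω hω N M).trans ?_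
  have hrel : ∀ M : Channel (A.Idx dim) (B.Idx dim), ((M.tensorLeft _).apply ω).mat =
      ((M.tensorLeft _).apply ((Channel.relabel (e.prodCongr (Equiv.refl _))).apply ω)).mat.submatrix
        (e.prodCongr (Equiv.refl (B.Idx dim))) (e.prodCongr (Equiv.refl _)) := by
    intro M
    ext ⟨x, k⟩ ⟨y, l⟩
    simp only [Channel.tensorLeft_apply_mat, Matrix.submatrix_apply, Equiv.prodCongr_apply,
      Prod.map_apply, Channel.relabel_apply_mat, Matrix.submatrix_submatrix]
    refine congrFun (congrFun (congrArg _ (Matrix.ext fun i j => ?_)) k) l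
    simp
  exact hst.relabel _ _ _ _ _ (hrel N) (hrel M)

variable {F A B}

theorem apply_mem_freeStates {X Y : PhysSystem S} {ρ : State (X.Idx dim)}
    (hρ : ρ ∈ F.freeStates X) {M : Channel (X.Idx dim) (Y.Idx dim)} (hM : M ∈ F.free X Y) :
    M.apply ρ ∈ F.freeStates Y := by
  obtain ⟨Φ, hΦ, rfl⟩ := hρ
  exact ⟨M.comp Φ, F.comp_mem _ hΦ _ hM, rfl⟩

/-- Appending a free state on the left is a free operation. -/
theorem exists_mem_free_pad (X : PhysSystem S) {Q : PhysSystem S} {τ : State (Q.Idx dim)}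
    (hτ : τ ∈ F.freeStates Q) : ∃ P ∈ F.free X (.tensor Q X),
      ∀ (M : Matrix (X.Idx dim) (X.Idx dim) ℂ) (x y : Q.Idx dim × X.Idx dim),
        P.toLin M x y = τ.mat x.1 y.1 * M x.2 y.2 := by
  obtain ⟨T, hT, rfl⟩ := hτ
  refine ⟨_, F.comp_mem _ (F.leftUnit_symm_mem X) _ (F.tensorRight_mem X _ hT), ?_⟩
  intro M x y
  have h1 : (((T.tensorRight (X.Idx dim)).comp
      (Channel.relabel (Equiv.punitProd (X.Idx dim)).symm)).toLin M) x y =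
      T.toLin (Matrix.of fun _ _ => M x.2 y.2) x.1 y.1 := rfl
  have h2 : (Matrix.of fun _ _ => M x.2 y.2 : Matrix Unit Unit ℂ) = M x.2 y.2 • 1 := by
    ext; simp
  refine h1.trans ?_
  erw [h2]
  erw [map_smul]
  exact mul_comm _ _

/-- Discarding `A` is free. This provides the free states with which the other branch is padded. -/
theorem exists_mem_freeStates_of_tensor {R : PhysSystem S}
    {ρ : State ((PhysSystem.tensor R A).Idx dim)}
    (hρ : ρ ∈ F.freeStates (.tensor R A)) : (F.freeStates R).Nonempty := by
  obtain ⟨D, hD⟩ := F.discard_nonempty A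
  exact ⟨_, apply_mem_freeStates (apply_mem_freeStates hρ (F.tensorLeft_mem R _ hD))
    (F.rightUnit_mem R)⟩

theorem ConvexStates.exists_mem {X : PhysSystem S} (h : F.ConvexStates X)
    {ρ₁ ρ₂ : State (X.Idx dim)} (h₁ : ρ₁ ∈ F.freeStates X) (h₂ : ρ₂ ∈ F.freeStates X)
    {a b : NNReal} (hab : a + b = 1) : ∃ ρ ∈ F.freeStates X,
      ∀ i j, ρ.mat i j = ((a : ℝ) : ℂ) * ρ₁.mat i j + ((b : ℝ) : ℂ) * ρ₂.mat i j := by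
  obtain ⟨ρ, hρ, he⟩ := h ⟨ρ₁, h₁, rfl⟩ ⟨ρ₂, h₂, rfl⟩ a.2 b.2 (congrArg NNReal.toReal hab)
  refine ⟨ρ, hρ, fun i j => ?_⟩
  rw [he]
  simp

theorem exists_flagged_mem_freeStates {Q R₁ R₂ : PhysSystem S}
    (hconv : ∀ R, F.ConvexStates (.tensor R A)) {ψ φ : Q.Idx dim → ℂ}
    {χ₁ χ₂ : State (Q.Idx dim)} (hχ₁ : χ₁ ∈ F.freeStates Q) (hχ₂ : χ₂ ∈ F.freeStates Q)
    (hψ : χ₁.mat = Matrix.vecMulVec ψ (star ψ)) (hφ : χ₂.mat = Matrix.vecMulVec φ (star φ))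
    {τ₁ : State (R₁.Idx dim)} {τ₂ : State (R₂.Idx dim)} (hτ₁ : τ₁ ∈ F.freeStates R₁)
    (hτ₂ : τ₂ ∈ F.freeStates R₂) {ρ₁ : State ((PhysSystem.tensor R₁ A).Idx dim)}
    (hρ₁ : ρ₁ ∈ F.freeStates (.tensor R₁ A)) {ρ₂ : State ((PhysSystem.tensor R₂ A).Idx dim)}
    (hρ₂ : ρ₂ ∈ F.freeStates (.tensor R₂ A)) {a b : NNReal} (hab : a + b = 1) :
    ∃ ω : State ((Q.Idx dim × (R₂.Idx dim × R₁.Idx dim)) × A.Idx dim),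
      ω ∈ F.freeStates (.tensor (.tensor Q (.tensor R₂ R₁)) A) ∧
    ∀ q s r i q' s' r' j, ω.mat ((q, (s, r)), i) ((q', (s', r')), j) =
      ((a : ℝ) : ℂ) * (ψ q * star (ψ q')) * (τ₂.mat s s' * ρ₁.mat (r, i) (r', j)) +
      ((b : ℝ) : ℂ) * (φ q * star (φ q')) * (τ₁.mat r r' * ρ₂.mat (s, i) (s', j)) := by
  obtain ⟨P₂, hP₂, hP₂'⟩ := exists_mem_free_pad (.tensor R₁ A) hτ₂
  obtain ⟨P₁, hP₁, hP₁'⟩ := exists_mem_free_pad A hτ₁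
  obtain ⟨Z₁, hZ₁, hZ₁'⟩ := exists_mem_free_pad (.tensor (.tensor R₂ R₁) A) hχ₁
  obtain ⟨Z₂, hZ₂, hZ₂'⟩ := exists_mem_free_pad (.tensor (.tensor R₂ R₁) A) hχ₂
  have hω₁ := apply_mem_freeStates (apply_mem_freeStates (apply_mem_freeStates
    (apply_mem_freeStates hρ₁ hP₂) (F.assoc_symm_mem R₂ R₁ A)) hZ₁)
    (F.assoc_symm_mem Q (.tensor R₂ R₁) A)
  -- Swapping tensor factors need not be free. Here `τ₁` is therefore inserted between `R₂` and `A`,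
  -- while `τ₂` is prepended to `R₁ A` in the first branch; both arrive at the order `R₂ R₁ A`.
  have hω₂ := apply_mem_freeStates (apply_mem_freeStates (apply_mem_freeStates
    (apply_mem_freeStates hρ₂ (F.tensorLeft_mem R₂ _ hP₁)) (F.assoc_symm_mem R₂ R₁ A)) hZ₂)
    (F.assoc_symm_mem Q (.tensor R₂ R₁) A)
  obtain ⟨ω, hω, he⟩ := (hconv _).exists_mem hω₁ hω₂ hab
  refine ⟨ω, hω, fun q s r i q' s' r' j => (he _ _).trans ?_⟩
  rw [mul_assoc ((a : ℝ) : ℂ), mul_assoc ((b : ℝ) : ℂ)]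
  refine congrArg₂ (· + ·) (congrArg _ ?_) (congrArg _ ?_)
  · refine (hZ₁' _ (q, ((s, r), i)) (q', ((s', r'), j))).trans ?_
    rw [hψ]
    exact congrArg (fun z => ψ q * star (ψ q') * z) (hP₂' _ (s, (r, i)) (s', (r', j)))
  · refine (hZ₂' _ (q, ((s, r), i)) (q', ((s', r'), j))).trans ?_
    rw [hφ]
    exact congrArg (fun z => φ q * star (φ q') * z) (hP₁' _ (r, i) (r', j))

variable (F A B)

theorem infSupFree_eq_supInfFree (N : Channel (A.Idx dim) (B.Idx dim))
    (hconv : F.ConvexChannels A B) {d : StateFunction} (hst : d.IsAncillaStable)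
    (hsnd : d.IsConvexSnd)
    (hd : (∃ K : NNReal, ∀ (ι : Type) [Fintype ι] (ρ σ : State ι), d ι ρ σ ≤ K) ∨ d.IsLscSnd)
    (hne : (F.free A B).Nonempty) (hstates : ∀ R, F.ConvexStates (.tensor R A))
    (hflags : F.HasFreeFlags) : F.infSupFree A B d N = F.supInfFree A B d N := by
  obtain ⟨Q, ψ, φ, hψφ, ⟨χ₁, hχ₁, hψ⟩, ⟨χ₂, hχ₂, hφ⟩⟩ := hflags
  have hunit : ∀ (ψ : Q.Idx dim → ℂ) (χ : State (Q.Idx dim)),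
      χ.mat = Matrix.vecMulVec ψ (star ψ) → star ψ ⬝ᵥ ψ = 1 := by
    intro ψ χ h
    rw [dotProduct_comm, ← Matrix.trace_vecMulVec, ← h, χ.trace_eq_one]
  have key := F.iInf_iSup_eq_iSup_iInf A B N hconv hne hsnd hd
    (Y := Σ R : PhysSystem S, F.freeStates (.tensor R A)) (fun y => y.1.Idx dim)
    (fun y => y.2.1) ?_
  · simpa only [infSupFree, supInfFree, iSup_sigma, iSup_subtype] using key
  rintro ⟨R₁, ρ₁, hρ₁⟩ ⟨R₂, ρ₂, hρ₂⟩ a b hab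
  obtain ⟨τ₁, hτ₁⟩ := exists_mem_freeStates_of_tensor hρ₁
  obtain ⟨τ₂, hτ₂⟩ := exists_mem_freeStates_of_tensor hρ₂
  obtain ⟨ω, hω, he⟩ :=
    exists_flagged_mem_freeStates hstates hχ₁ hχ₂ hψ hφ hτ₁ hτ₂ hρ₁ hρ₂ hab
  exact ⟨⟨.tensor Q (.tensor R₂ R₁), ω, hω⟩, fun M => hst.add_le (hunit ψ χ₁ hψ) (hunit φ χ₂ hφ) hψφ τ₁ τ₂ ρ₁ ρ₂ hab ω he
    N M⟩

end ResourceTheory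

/-! ### Spectral formula for the relative entropy -/

/-- The columns of the unitary `U` are eigenvectors of `M`, with eigenvalues `l`. -/
def Diagonalizes {n : Type*} [Fintype n] [DecidableEq n] (U : Matrix n n ℂ) (l : n → ℝ)
    (M : Matrix n n ℂ) : Prop :=
  star U * U = 1 ∧ M = U * Matrix.diagonal (fun i => (l i : ℂ)) * star U

namespace Diagonalizes

variable {n : Type*} [Fintype n] [DecidableEq n] {U V : Matrix n n ℂ} {l m : n → ℝ}
  {M N : Matrix n n ℂ}

theorem mul_star (h : Diagonalizes U l M) : U * star U = 1 := mul_eq_one_comm.1 h.1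

theorem isHermitian (h : Diagonalizes U l M) : M.IsHermitian := by
  rw [h.2, Matrix.IsHermitian, ← Matrix.star_eq_conjTranspose, star_mul, star_mul, star_star,
    ← mul_assoc]
  congr 2
  rw [Matrix.star_eq_conjTranspose, Matrix.diagonal_conjTranspose]
  congr 1
  ext i
  simp

theorem star_mul_mul (h : Diagonalizes U l M) :
    star U * M * U = Matrix.diagonal (fun i => (l i : ℂ)) := by
  rw [h.2, ← mul_assoc, ← mul_assoc, h.1, one_mul, mul_assoc, h.1, mul_one]

theorem _root_.Matrix.IsHermitian.exists_diagonalizes (h : M.IsHermitian) :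
    Diagonalizes (h.eigenvectorUnitary : Matrix n n ℂ) h.eigenvalues M :=
  ⟨Unitary.coe_star_mul_self _, by
    conv_lhs => rw [h.spectral_theorem, Unitary.conjStarAlgAut_apply]
    rfl⟩

/-- Any diagonalization may be used to compute the functional calculus. Between two eigenbases,
`star V * U` has a nonzero entry only where the eigenvalues agree, so it also intertwines their
images under `f`. -/
theorem cfc_eq (h : Diagonalizes U l M) (f : ℝ → ℝ) : Diagonalizes U (f ∘ l) (cfc f M) := by
  refine ⟨h.1, ?_⟩
  obtain ⟨V, m, hV, hf⟩ : ∃ (V : Matrix n n ℂ) (m : n → ℝ), Diagonalizes V m M ∧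
      cfc f M = V * Matrix.diagonal (fun i => ((f (m i) : ℝ) : ℂ)) * star V := by
    refine ⟨_, _, h.isHermitian.exists_diagonalizes, ?_⟩
    rw [h.isHermitian.cfc_eq, Matrix.IsHermitian.cfc, Unitary.conjStarAlgAut_apply]
    rfl
  have hcomm : Matrix.diagonal (fun i => (m i : ℂ)) * (star V * U) =
      (star V * U) * Matrix.diagonal (fun i => (l i : ℂ)) := by
    rw [← hV.star_mul_mul, ← h.star_mul_mul]
    calc star V * M * V * (star V * U) = star V * M * (V * star V) * U := by noncomm_ring
      _ = star V * (U * star U) * M * U := by rw [hV.mul_star, h.mul_star]; noncomm_ring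
      _ = _ := by noncomm_ring
  have hcomm' : Matrix.diagonal (fun i => ((f (m i) : ℝ) : ℂ)) * (star V * U) =
      (star V * U) * Matrix.diagonal (fun i => ((f (l i) : ℝ) : ℂ)) := by
    ext i j
    have := congrFun (congrFun hcomm i) j
    rw [Matrix.diagonal_mul, Matrix.mul_diagonal] at this ⊢
    by_cases hz : (star V * U) i j = 0
    · simp [hz]
    · have hml : (m i : ℂ) = l j := by
        rw [mul_comm] at this
        exact mul_left_cancel₀ hz this
      rw [Complex.ofReal_inj.1 hml, mul_comm]
  rw [hf]
  calc V * Matrix.diagonal (fun i => ((f (m i) : ℝ) : ℂ)) * star V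
      = V * (Matrix.diagonal (fun i => ((f (m i) : ℝ) : ℂ)) * (star V * U)) * star U := by
        have : V * Matrix.diagonal (fun i => ((f (m i) : ℝ) : ℂ)) * star V * (U * star U) =
          V * (Matrix.diagonal (fun i => ((f (m i) : ℝ) : ℂ)) * (star V * U)) * star U := by
          noncomm_ring
        rw [← this, h.mul_star, mul_one]
    _ = (V * star V) * U * Matrix.diagonal (fun i => ((f (l i) : ℝ) : ℂ)) * star U := by
        rw [hcomm']; noncomm_ring
    _ = _ := by rw [hV.mul_star, one_mul]; rfl

theorem trace_eq (h : Diagonalizes U l M) : M.trace = ((∑ i, l i : ℝ) : ℂ) := by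
  rw [h.2, Matrix.trace_mul_cycle, h.1, one_mul, Matrix.trace_diagonal]
  push_cast
  rfl

/-- The weights are the squared overlaps of the two eigenbases; they form a doubly stochastic
matrix. -/
theorem trace_mul (h : Diagonalizes U l M) (h' : Diagonalizes V m N) :
    (M * N).trace = ((∑ i, ∑ j, ‖(star U * V) i j‖ ^ 2 * (l i * m j) : ℝ) : ℂ) := by
  rw [h.2, h'.2]
  have e1 : (U * Matrix.diagonal (fun i => (l i : ℂ)) * star U *
      (V * Matrix.diagonal (fun i => (m i : ℂ)) * star V)).trace =
      (Matrix.diagonal (fun i => (l i : ℂ)) * (star U * V) *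
        (Matrix.diagonal (fun i => (m i : ℂ)) * star (star U * V))).trace := by
    rw [star_mul, star_star, mul_assoc U, mul_assoc U, Matrix.trace_mul_comm U]
    congr 1
    noncomm_ring
  rw [e1, Matrix.trace]
  push_cast
  refine Finset.sum_congr rfl fun i _ => ?_
  rw [Matrix.diag_apply, Matrix.mul_apply]
  refine Finset.sum_congr rfl fun j _ => ?_
  rw [Matrix.diagonal_mul, Matrix.diagonal_mul, Matrix.star_apply]
  have : ((‖(star U * V) i j‖ : ℂ)) ^ 2 = (star U * V) i j * star ((star U * V) i j) := by
    rw [Complex.star_def, Complex.mul_conj, Complex.normSq_eq_norm_sq]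
    push_cast
    rfl
  rw [this]
  ring

theorem star_mul_unitary (h : Diagonalizes U l M) (h' : Diagonalizes V m N) :
    star (star U * V) * (star U * V) = 1 := by
  rw [star_mul, star_star]
  calc star V * U * (star U * V) = star V * (U * star U) * V := by noncomm_ring
    _ = 1 := by rw [h.mul_star, mul_one, h'.1]

theorem sum_norm_sq_col (h : Diagonalizes U l M) (h' : Diagonalizes V m N) (j : n) :
    ∑ i, ‖(star U * V) i j‖ ^ 2 = 1 := by
  have e := congrFun (congrFun (h.star_mul_unitary h') j) j
  rw [Matrix.mul_apply, Matrix.one_apply_eq] at e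
  have : ((∑ i, ‖(star U * V) i j‖ ^ 2 : ℝ) : ℂ) = 1 := by
    rw [← e]
    push_cast
    refine Finset.sum_congr rfl fun i _ => ?_
    rw [Matrix.star_apply, mul_comm, Complex.star_def, Complex.mul_conj, Complex.normSq_eq_norm_sq]
    push_cast
    rfl
  exact_mod_cast this

theorem sum_norm_sq_row (h : Diagonalizes U l M) (h' : Diagonalizes V m N) (i : n) :
    ∑ j, ‖(star U * V) i j‖ ^ 2 = 1 := by
  rw [← h'.sum_norm_sq_col h i]
  refine Finset.sum_congr rfl fun j _ => ?_
  have : star U * V = star (star V * U) := by rw [star_mul, star_star]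
  rw [this, Matrix.star_apply, norm_star]

theorem support_le_iff (h : Diagonalizes U l M) (h' : Diagonalizes V m N) :
    (∀ v : n → ℂ, N.mulVec v = 0 → M.mulVec v = 0) ↔
      ∀ i j, m j = 0 → l i ≠ 0 → (star U * V) i j = 0 := by
  constructor
  · intro hv i j hm hl
    have h1 : N.mulVec (V.mulVec (Pi.single j 1)) = 0 := by
      rw [Matrix.mulVec_mulVec, h'.2, mul_assoc, h'.1, mul_one, ← Matrix.mulVec_mulVec,
        Matrix.mulVec_single_one]
      have : (Matrix.diagonal fun i => (m i : ℂ)).col j = 0 := by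
        ext k
        rw [Matrix.col_apply, Matrix.diagonal_apply]
        split_ifs with hk
        · subst hk; simp [hm]
        · rfl
      rw [this, Matrix.mulVec_zero]
    have h2 := congrArg (fun w => (star U).mulVec w) (hv _ h1)
    simp only [Matrix.mulVec_mulVec, Matrix.mulVec_zero] at h2
    have h3 : star U * (M * V) = Matrix.diagonal (fun i => (l i : ℂ)) * (star U * V) := by
      rw [← h.star_mul_mul]
      calc star U * (M * V) = star U * M * 1 * V := by noncomm_ring
        _ = _ := by rw [← h.mul_star]; noncomm_ring
    rw [h3, Matrix.mulVec_single_one] at h2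
    have h4 := congrFun h2 i
    rw [Matrix.col_apply, Matrix.diagonal_mul, Pi.zero_apply] at h4
    exact (mul_eq_zero.1 h4).resolve_left (by exact_mod_cast hl)
  · intro hW v hv
    have h1 : ∀ j, m j ≠ 0 → (star V).mulVec v j = 0 := by
      intro j hj
      have e := congrFun (congrArg (fun w => (star V).mulVec w) hv) j
      have h3 : star V * N = Matrix.diagonal (fun i => (m i : ℂ)) * star V := by
        rw [h'.2, ← mul_assoc, ← mul_assoc, h'.1, one_mul]
      simp only [Matrix.mulVec_mulVec, h3, Matrix.mulVec_zero] at e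
      rw [← Matrix.mulVec_mulVec, Matrix.mulVec_diagonal, Pi.zero_apply] at e
      exact (mul_eq_zero.1 e).resolve_left (by exact_mod_cast hj)
    have h2 : (star U).mulVec v = (star U * V).mulVec ((star V).mulVec v) := by
      rw [Matrix.mulVec_mulVec, mul_assoc, h'.mul_star, mul_one]
    rw [h.2, mul_assoc, ← Matrix.mulVec_mulVec, ← Matrix.mulVec_mulVec]
    refine Eq.trans (congrArg _ (funext fun i => ?_)) (Matrix.mulVec_zero U)
    rw [Matrix.mulVec_diagonal, h2, Pi.zero_apply]
    by_cases hl : l i = 0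
    · simp [hl]
    · convert mul_zero _
      refine Finset.sum_eq_zero fun j _ => ?_
      by_cases hm : m j = 0
      · exact mul_eq_zero_of_left (hW i j hm hl) _
      · rw [h1 j hm, mul_zero]

end Diagonalizes

/-- The contribution of a pair of eigenvalues to the relative entropy. -/
noncomputable def klTerm (a b : ℝ) : ℝ≥0∞ :=
  open Classical in
  if b = 0 ∧ a ≠ 0 then ∞ else ENNReal.ofReal (a * Real.log a - a * Real.log b + b - a)

/-- For `a > 0` this is `log x ≤ x - 1` at `x = b / a`. The correction `b - a` in `klTerm` makes
each term non-negative; for two states its weighted sum vanishes, as both traces are one. -/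
theorem klTerm_arg_nonneg {a b : ℝ} (ha : 0 ≤ a) (hb : 0 ≤ b) (h : ¬(b = 0 ∧ a ≠ 0)) :
    0 ≤ a * Real.log a - a * Real.log b + b - a := by
  rcases ha.eq_or_lt with rfl | ha
  · simpa using hb
  · have hb' : 0 < b := hb.lt_of_ne fun h0 => h ⟨h0.symm, ha.ne'⟩
    have := Real.log_le_sub_one_of_pos (div_pos hb' ha)
    rw [Real.log_div hb'.ne' ha.ne'] at this
    have h2 := mul_le_mul_of_nonneg_left this ha.le
    have h3 : a * (b / a - 1) = b - a := by field_simp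
    rw [h3] at h2
    linarith

theorem klTerm_mul {a b c : ℝ} (hc : 0 ≤ c) :
    klTerm (c * a) (c * b) = ENNReal.ofReal c * klTerm a b := by
  rcases hc.eq_or_lt with rfl | hc
  · simp [klTerm]
  unfold klTerm
  by_cases h : b = 0 ∧ a ≠ 0
  · rw [if_pos h, if_pos (by simp [h.1, h.2, hc.ne']), ENNReal.mul_top]
    simpa using hc
  · rw [if_neg h, if_neg (by simpa [hc.ne'] using h), ← ENNReal.ofReal_mul hc.le]
    congr 1
    by_cases ha : a = 0
    · simp [ha]
    · have hb : b ≠ 0 := fun hb => h ⟨hb, ha⟩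
      rw [Real.log_mul hc.ne' ha, Real.log_mul hc.ne' hb]
      ring

section formula

variable [DecidableEq ι] {ρ σ : State ι} {U V : Matrix ι ι ℂ} {l m : ι → ℝ}

theorem State.exists_diagonalizes (ρ : State ι) : ∃ (U : Matrix ι ι ℂ) (l : ι → ℝ),
    Diagonalizes U l ρ.mat := ⟨_, _, ρ.posSemidef.1.exists_diagonalizes⟩

theorem Diagonalizes.sum_eq_one (h : Diagonalizes U l ρ.mat) : ∑ i, l i = 1 := by
  have := h.trace_eq
  rw [ρ.trace_eq_one] at this
  exact_mod_cast this.symm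

theorem Diagonalizes.nonneg (h : Diagonalizes U l ρ.mat) (i : ι) : 0 ≤ l i := by
  have h1 := ρ.posSemidef.conjTranspose_mul_mul_same U
  rw [← Matrix.star_eq_conjTranspose, h.star_mul_mul] at h1
  have := h1.diag_nonneg (i := i)
  rw [Matrix.diagonal_apply_eq] at this
  exact_mod_cast this

/-- `N` is not required to be a state: the regularized matrix `σ + ε` is also used. -/
theorem trace_relEntropy_eq (h : Diagonalizes U l ρ.mat) {N : Matrix ι ι ℂ}
    (h' : Diagonalizes V m N) :
    (ρ.mat * cfc Real.log ρ.mat - ρ.mat * cfc Real.log N).trace.re =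
      ∑ i, ∑ j, ‖(star U * V) i j‖ ^ 2 * (l i * Real.log (l i) - l i * Real.log (m j)) := by
  have h1 : ρ.mat * cfc Real.log ρ.mat =
      U * Matrix.diagonal (fun i => ((l i * Real.log (l i) : ℝ) : ℂ)) * star U := by
    rw [(h.cfc_eq Real.log).2]
    conv_lhs => rw [h.2]
    calc _ = U * Matrix.diagonal (fun i => (l i : ℂ)) * (star U * U) *
          Matrix.diagonal (fun i => (((Real.log ∘ l) i : ℝ) : ℂ)) * star U := by noncomm_ring
      _ = U * (Matrix.diagonal (fun i => (l i : ℂ)) *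
          Matrix.diagonal (fun i => (((Real.log ∘ l) i : ℝ) : ℂ))) * star U := by
          rw [h.1]; noncomm_ring
      _ = _ := by
          rw [Matrix.diagonal_mul_diagonal]
          simp
  have h2 : Diagonalizes U (fun i => l i * Real.log (l i)) (ρ.mat * cfc Real.log ρ.mat) :=
    ⟨h.1, h1⟩
  rw [Matrix.trace_sub, h2.trace_eq, h.trace_mul (h'.cfc_eq Real.log), ← Complex.ofReal_sub,
    Complex.ofReal_re, ← Finset.sum_sub_distrib]
  refine Finset.sum_congr rfl fun i _ => ?_
  simp only [mul_sub, Finset.sum_sub_distrib, ← Finset.sum_mul, h.sum_norm_sq_row h', one_mul,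
    Function.comp_apply]

/-- By double stochasticity the corrections add up to the trace of `σ + ε` minus that of `ρ`. -/
theorem sum_klTerm_arg (h : Diagonalizes U l ρ.mat) (h' : Diagonalizes V m σ.mat) (ε : ℝ) :
    ∑ i, ∑ j, ‖(star U * V) i j‖ ^ 2 *
        (l i * Real.log (l i) - l i * Real.log (m j + ε) + (m j + ε) - l i) =
      ∑ i, ∑ j, ‖(star U * V) i j‖ ^ 2 * (l i * Real.log (l i) - l i * Real.log (m j + ε)) +
        Fintype.card ι * ε := by
  have e1 : ∑ i, ∑ j, ‖(star U * V) i j‖ ^ 2 * l i = 1 := by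
    simp only [← Finset.sum_mul, h.sum_norm_sq_row h', one_mul, h.sum_eq_one]
  have e2 : ∑ i, ∑ j, ‖(star U * V) i j‖ ^ 2 * (m j + ε) = 1 + Fintype.card ι * ε := by
    rw [Finset.sum_comm]
    simp only [← Finset.sum_mul, h.sum_norm_sq_col h', one_mul, h'.sum_eq_one,
      Finset.sum_add_distrib, Finset.sum_const, Finset.card_univ, nsmul_eq_mul]
  have e3 : ∀ i j, ‖(star U * V) i j‖ ^ 2 *
      (l i * Real.log (l i) - l i * Real.log (m j + ε) + (m j + ε) - l i) =
      ‖(star U * V) i j‖ ^ 2 * (l i * Real.log (l i) - l i * Real.log (m j + ε)) +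
      ‖(star U * V) i j‖ ^ 2 * (m j + ε) - ‖(star U * V) i j‖ ^ 2 * l i := fun i j => by ring
  simp only [e3, Finset.sum_sub_distrib, Finset.sum_add_distrib, e1, e2]
  ring

theorem relEntropy_eq_ite (h : Diagonalizes U l ρ.mat) (h' : Diagonalizes V m σ.mat)
    [Decidable (∀ i j, m j = 0 → l i ≠ 0 → (star U * V) i j = 0)] :
    relEntropy ι ρ σ = if ∀ i j, m j = 0 → l i ≠ 0 → (star U * V) i j = 0 then
      ENNReal.ofReal (∑ i, ∑ j, ‖(star U * V) i j‖ ^ 2 *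
        (l i * Real.log (l i) - l i * Real.log (m j))) else ∞ := by
  rw [← trace_relEntropy_eq h h', relEntropy]
  simp only [h.support_le_iff h']
  congr!

/-- If the supports are nested, infinite terms have overlap zero and `0 * ∞ = 0` removes them;
otherwise one of them has positive weight. -/
theorem relEntropy_eq_sum (h : Diagonalizes U l ρ.mat) (h' : Diagonalizes V m σ.mat) :
    relEntropy ι ρ σ =
      ∑ i, ∑ j, ENNReal.ofReal (‖(star U * V) i j‖ ^ 2) * klTerm (l i) (m j) := by
  classical
  rw [relEntropy_eq_ite h h']
  split_ifs with hc
  · have e := sum_klTerm_arg h h' 0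
    simp only [add_zero, mul_zero] at e
    have hnn : ∀ i j, 0 ≤ ‖(star U * V) i j‖ ^ 2 *
        (l i * Real.log (l i) - l i * Real.log (m j) + m j - l i) := by
      intro i j
      by_cases hk : m j = 0 ∧ l i ≠ 0
      · simp [hc i j hk.1 hk.2]
      · exact mul_nonneg (by positivity) (klTerm_arg_nonneg (h.nonneg i) (h'.nonneg j) hk)
    rw [← e, ENNReal.ofReal_sum_of_nonneg fun i _ => Finset.sum_nonneg fun j _ => hnn i j]
    refine Finset.sum_congr rfl fun i _ => ?_
    rw [ENNReal.ofReal_sum_of_nonneg fun j _ => hnn i j]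
    refine Finset.sum_congr rfl fun j _ => ?_
    by_cases hk : m j = 0 ∧ l i ≠ 0
    · simp [hc i j hk.1 hk.2]
    · rw [ENNReal.ofReal_mul (by positivity), klTerm, if_neg hk]
  · push Not at hc
    obtain ⟨i, j, hm, hl, hw⟩ := hc
    symm
    rw [ENNReal.sum_eq_top]
    refine ⟨i, Finset.mem_univ _, ENNReal.sum_eq_top.2 ⟨j, Finset.mem_univ _, ?_⟩⟩
    rw [klTerm, if_pos ⟨hm, hl⟩, ENNReal.mul_top]
    have : 0 < ‖(star U * V) i j‖ ^ 2 := by positivity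
    simpa using this.not_ge

end formula

/-! ### Relative entropy of block-diagonal states -/

variable {Q : Type} [Fintype Q]

theorem relEntropy_submatrix (e : ι ≃ κ) (ρ σ : State κ) (ρ' σ' : State ι)
    (hρ : ρ'.mat = ρ.mat.submatrix e e) (hσ : σ'.mat = σ.mat.submatrix e e) :
    relEntropy ι ρ' σ' = relEntropy κ ρ σ := by
  classical
  obtain ⟨U, l, hU⟩ := ρ.exists_diagonalizes
  obtain ⟨V, m, hV⟩ := σ.exists_diagonalizes
  have hstar : ∀ U : Matrix κ κ ℂ, star (U.submatrix e e) = (star U).submatrix e e := fun _ => rfl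
  have key : ∀ {M : Matrix κ κ ℂ} {U : Matrix κ κ ℂ} {l : κ → ℝ}, Diagonalizes U l M →
      Diagonalizes (U.submatrix e e) (l ∘ e) (M.submatrix e e) := by
    intro M U l h
    refine ⟨?_, ?_⟩
    · rw [hstar, Matrix.submatrix_mul_equiv, h.1, Matrix.submatrix_one_equiv]
    · have : (Matrix.diagonal fun i => (((l ∘ e) i : ℝ) : ℂ)) =
          (Matrix.diagonal fun i => ((l i : ℝ) : ℂ)).submatrix e e := by
        rw [Matrix.submatrix_diagonal_equiv]
        rfl
      rw [hstar, this, Matrix.submatrix_mul_equiv, Matrix.submatrix_mul_equiv, ← h.2]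
  rw [relEntropy_eq_sum hU hV, relEntropy_eq_sum (hρ ▸ key hU) (hσ ▸ key hV)]
  simp only [hstar, Matrix.submatrix_mul_equiv, Matrix.submatrix_apply, Function.comp_apply]
  rw [← Equiv.sum_comp e]
  exact Finset.sum_congr rfl fun i _ => Equiv.sum_comp e
    (fun j => ENNReal.ofReal (‖(star U * V) (e i) j‖ ^ 2) * klTerm (l (e i)) (m j))

/-- The relative entropy of block-diagonal states with the same weights is the average of the
relative entropies of the blocks. -/
theorem relEntropy_sum_kronecker [DecidableEq Q] {E : Matrix Q Q ℂ} (hE : star E * E = 1)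
    {c : Q → ℝ} (hc : ∀ q, 0 ≤ c q) (ρ σ : Q → State ι) (ω ω' : State (Q × ι))
    (hω : ∀ x y, ω.mat x y =
      ∑ q, (c q : ℂ) * (E x.1 q * star (E y.1 q)) * (ρ q).mat x.2 y.2)
    (hω' : ∀ x y, ω'.mat x y =
      ∑ q, (c q : ℂ) * (E x.1 q * star (E y.1 q)) * (σ q).mat x.2 y.2) :
    relEntropy (Q × ι) ω ω' = ∑ q, ENNReal.ofReal (c q) * relEntropy ι (ρ q) (σ q) := by
  classical
  choose U l hU using fun q => (ρ q).exists_diagonalizes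
  choose V m hV using fun q => (σ q).exists_diagonalizes
  have hEE : ∀ q q', ∑ p, star (E p q) * E p q' = if q = q' then 1 else 0 := by
    intro q q'
    have := congrFun (congrFun hE q) q'
    simpa only [Matrix.mul_apply, Matrix.star_apply, Matrix.one_apply] using this
  -- In the product eigenbases, vectors of different blocks have overlap zero; only the diagonal
  -- blocks contribute, and there the weight `c q` factors out because `klTerm` is homogeneous.
  have hover : ∀ (U V : Q → Matrix ι ι ℂ) (q q' : Q) (i j : ι),
      (star (Matrix.of fun x y : Q × ι => E x.1 y.1 * U y.1 x.2 y.2) *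
        (Matrix.of fun x y : Q × ι => E x.1 y.1 * V y.1 x.2 y.2)) (q, i) (q', j) =
      if q = q' then (star (U q) * V q') i j else 0 := by
    intro U V q q' i j
    simp only [Matrix.mul_apply, Matrix.star_apply, Matrix.of_apply, Fintype.sum_prod_type,
      star_mul']
    have : ∀ p k, star (E p q) * star (U q k i) * (E p q' * V q' k j) =
        (star (E p q) * E p q') * (star (U q k i) * V q' k j) := fun p k => by ring
    simp only [this, ← Finset.mul_sum, ← Finset.sum_mul, hEE, ite_mul, one_mul, zero_mul]
  have key : ∀ {U : Q → Matrix ι ι ℂ} {l : Q → ι → ℝ} {ρ : Q → State ι} {ω : State (Q × ι)},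
      (∀ q, Diagonalizes (U q) (l q) (ρ q).mat) → (∀ x y, ω.mat x y =
        ∑ q, (c q : ℂ) * (E x.1 q * star (E y.1 q)) * (ρ q).mat x.2 y.2) →
      Diagonalizes (Matrix.of fun x y : Q × ι => E x.1 y.1 * U y.1 x.2 y.2)
        (fun x => c x.1 * l x.1 x.2) ω.mat := by
    intro U l ρ ω h hω
    refine ⟨?_, ?_⟩
    · ext ⟨q, i⟩ ⟨q', j⟩
      rw [hover]
      by_cases hq : q = q'
      · subst hq
        rw [if_pos rfl, (h q).1]
        simp [Matrix.one_apply]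
      · simp [hq]
    · ext x y
      rw [hω, Matrix.mul_apply, Fintype.sum_prod_type]
      refine Finset.sum_congr rfl fun q _ => ?_
      rw [(h q).2, Matrix.mul_apply, Finset.mul_sum]
      refine Finset.sum_congr rfl fun i _ => ?_
      simp only [Matrix.mul_diagonal, Matrix.of_apply, Matrix.star_apply, star_mul']
      push_cast
      ring
  rw [relEntropy_eq_sum (key hU hω) (key hV hω'), Fintype.sum_prod_type]
  refine Finset.sum_congr rfl fun q _ => ?_
  rw [relEntropy_eq_sum (hU q) (hV q), Finset.mul_sum]
  refine Finset.sum_congr rfl fun i _ => ?_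
  rw [Fintype.sum_prod_type, Finset.sum_eq_single q, Finset.mul_sum]
  · refine Finset.sum_congr rfl fun j _ => ?_
    rw [hover, if_pos rfl, klTerm_mul (hc q)]
    ring
  · intro q' _ hq'
    refine Finset.sum_eq_zero fun j _ => ?_
    rw [hover, if_neg hq'.symm]
    simp
  · simp

theorem relEntropy_prod (τ : State Q) (ρ σ : State ι) (ω ω' : State (Q × ι))
    (hω : ω.mat = τ.mat ⊗ₖ ρ.mat) (hω' : ω'.mat = τ.mat ⊗ₖ σ.mat) :
    relEntropy (Q × ι) ω ω' = relEntropy ι ρ σ := by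
  classical
  obtain ⟨E, c, hE⟩ := τ.exists_diagonalizes
  have key : ∀ (ρ : State ι) (ω : State (Q × ι)), ω.mat = τ.mat ⊗ₖ ρ.mat → ∀ x y, ω.mat x y =
      ∑ q, (c q : ℂ) * (E x.1 q * star (E y.1 q)) * ρ.mat x.2 y.2 := by
    intro ρ ω h x y
    rw [h, Matrix.kronecker_apply, hE.2, Matrix.mul_apply, Finset.sum_mul]
    refine Finset.sum_congr rfl fun q _ => ?_
    rw [Matrix.mul_diagonal, Matrix.star_apply]
    ring
  rw [relEntropy_sum_kronecker hE.1 hE.nonneg (fun _ => ρ) (fun _ => σ) ω ω' (key ρ ω hω)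
    (key σ ω' hω'), ← Finset.sum_mul, ← ENNReal.ofReal_sum_of_nonneg fun q _ => hE.nonneg q,
    hE.sum_eq_one, ENNReal.ofReal_one, one_mul]

/-- Two orthonormal vectors are two of the columns of a unitary matrix. -/
theorem exists_unitary_of_orthonormal [DecidableEq Q] {ψ φ : Q → ℂ} (hψ : star ψ ⬝ᵥ ψ = 1)
    (hφ : star φ ⬝ᵥ φ = 1) (hψφ : star ψ ⬝ᵥ φ = 0) : ∃ (E : Matrix Q Q ℂ) (q₁ q₂ : Q),
      star E * E = 1 ∧ q₁ ≠ q₂ ∧ (∀ p, E p q₁ = ψ p) ∧ (∀ p, E p q₂ = φ p) := by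
  have hinner : ∀ v w : Q → ℂ, inner ℂ (WithLp.toLp 2 v) (WithLp.toLp 2 w) = star v ⬝ᵥ w := by
    intro v w
    rw [EuclideanSpace.inner_toLp_toLp, dotProduct_comm]
  have hφψ : star φ ⬝ᵥ ψ = 0 := by
    have := congrArg star hψφ
    rwa [← Matrix.star_dotProduct_star, star_star, star_zero] at this
  have hon : Orthonormal ℂ ![WithLp.toLp 2 ψ, WithLp.toLp 2 φ] := by
    rw [orthonormal_iff_ite]
    intro i j
    fin_cases i <;> fin_cases j <;> simp [-inner_self_eq_norm_sq_to_K, hinner, hψ, hφ, hψφ, hφψ]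
  have hcard : 1 < Fintype.card Q := by
    have := hon.linearIndependent.fintype_card_le_finrank
    rwa [Fintype.card_fin, finrank_euclideanSpace] at this
  obtain ⟨q₁, q₂, hq⟩ := Fintype.one_lt_card_iff.1 hcard
  have hon' : Orthonormal ℂ (({q₁, q₂} : Set Q).domRestrict
      fun q => if q = q₁ then WithLp.toLp 2 ψ else WithLp.toLp 2 φ) := by
    rw [orthonormal_iff_ite]
    rintro ⟨i, rfl | rfl⟩ ⟨j, rfl | rfl⟩ <;>
      simp [-inner_self_eq_norm_sq_to_K, Subtype.ext_iff, hinner, hψ, hφ, hψφ, hφψ, hq, hq.symm]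
  obtain ⟨b, hb⟩ := hon'.exists_orthonormalBasis_extension_of_card_eq (by simp)
  refine ⟨Matrix.of fun p q => b q p, q₁, q₂, ?_, hq, ?_, ?_⟩
  · ext q q'
    have := orthonormal_iff_ite.1 b.orthonormal q q'
    rw [PiLp.inner_apply] at this
    simpa [Matrix.mul_apply, Matrix.one_apply, mul_comm] using this
  · intro p
    simp [hb q₁ (by simp)]
  · intro p
    simp [hb q₂ (by simp), hq.symm]

theorem relEntropy_isAncillaStable : relEntropy.IsAncillaStable where
  relabel e ρ σ ρ' σ' hρ hσ := (relEntropy_submatrix e ρ σ ρ' σ' hρ hσ).le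
  pad τ ρ σ ω ω' hω hω' := (relEntropy_prod τ ρ σ ω ω' hω hω').ge
  flag := by
    intro Q ι _ _ ψ φ hψ hφ hψφ a b hab ρ₁ σ₁ ρ₂ σ₂ ω ω' hω hω'
    classical
    obtain ⟨E, q₁, q₂, hE, hq, h₁, h₂⟩ := exists_unitary_of_orthonormal hψ hφ hψφ
    have hsum : ∀ {α : Type} [AddCommMonoid α] (f : Q → α), (∀ q, q ≠ q₁ → q ≠ q₂ → f q = 0) →
        ∑ q, f q = f q₁ + f q₂ := by
      intro α _ f hf
      exact Finset.sum_eq_add q₁ q₂ hq (fun q _ h => hf q h.1 h.2) (by simp) (by simp)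
    -- Basis vectors other than the two flags get weight `0`, so the states put in their blocks are
    -- irrelevant.
    let c : Q → ℝ := fun q => if q = q₁ then a else if q = q₂ then b else 0
    have c₁ : c q₁ = a := if_pos rfl
    have c₂ : c q₂ = b := by simp [c, hq.symm]
    have c₀ : ∀ q, q ≠ q₁ → q ≠ q₂ → c q = 0 := fun q h h' => by simp [c, h, h']
    have key : ∀ (ρ₁ ρ₂ : State ι) (ω : State (Q × ι)),
        ω.mat = ((a : ℝ) : ℂ) • (Matrix.vecMulVec ψ (star ψ) ⊗ₖ ρ₁.mat) +
          ((b : ℝ) : ℂ) • (Matrix.vecMulVec φ (star φ) ⊗ₖ ρ₂.mat) → ∀ x y, ω.mat x y =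
      ∑ q, (c q : ℂ) * (E x.1 q * star (E y.1 q)) *
        (if q = q₁ then ρ₁ else ρ₂ : State ι).mat x.2 y.2 := by
      intro ρ₁ ρ₂ ω h x y
      rw [hsum _ (fun q hq hq' => by rw [c₀ q hq hq']; simp), c₁, c₂, if_pos rfl,
        if_neg hq.symm, h₁, h₂, h₁, h₂, h]
      simp [Matrix.vecMulVec_apply, mul_assoc]
    have hc : ∀ q, 0 ≤ c q := fun q => by
      simp only [c]
      split_ifs
      exacts [a.2, b.2, le_rfl]
    rw [relEntropy_sum_kronecker hE hc (fun q => if q = q₁ then ρ₁ else ρ₂)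
      (fun q => if q = q₁ then σ₁ else σ₂) ω ω' (key ρ₁ ρ₂ ω hω) (key σ₁ σ₂ ω' hω'),
      hsum _ (fun q hq hq' => by rw [c₀ q hq hq']; simp), c₁, c₂]
    simp [hq.symm]


/-! ### Convexity and lower semicontinuity of the relative entropy by regularization -/

open Filter Topology

theorem Diagonalizes.add_smul_one {n : Type*} [Fintype n] [DecidableEq n] {U M : Matrix n n ℂ}
    {l : n → ℝ} (h : Diagonalizes U l M) (ε : ℝ) :
    Diagonalizes U (fun i => l i + ε) (M + ε • 1) := by
  refine ⟨h.1, ?_⟩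
  have : Matrix.diagonal (fun i => ((l i + ε : ℝ) : ℂ)) =
      Matrix.diagonal (fun i => (l i : ℂ)) + ε • 1 := by
    ext i j
    by_cases hij : i = j
    · subst hij; simp
    · simp [hij]
  rw [this, mul_add, add_mul, ← h.2, Matrix.mul_smul, Matrix.smul_mul, mul_one, h.mul_star]

section

open scoped Matrix.Norms.L2Operator MatrixOrder

theorem trace_mul_re_nonneg {n : Type*} [Fintype n] {M N : Matrix n n ℂ} (hM : M.PosSemidef)
    (hN : N.PosSemidef) : 0 ≤ (M * N).trace.re := by
  classical
  obtain ⟨B, rfl⟩ := CStarAlgebra.nonneg_iff_eq_star_mul_self.1 hM.nonneg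
  rw [mul_assoc, Matrix.trace_mul_comm, Matrix.star_eq_conjTranspose]
  exact (Complex.le_def.1 (hN.mul_mul_conjTranspose_same B).trace_nonneg).1

/-- Operator concavity of the logarithm, paired with the positive matrix `M`. -/
theorem concaveOn_trace_mul_log {n : Type*} [Fintype n] [DecidableEq n] {M : Matrix n n ℂ}
    (hM : M.PosSemidef) : ConcaveOn ℝ {N : Matrix n n ℂ | N.PosDef}
      fun N => (M * cfc Real.log N).trace.re := by
  have h := CFC.concaveOn_log (A := Matrix n n ℂ)
  simp only [Matrix.isStrictlyPositive_iff_posDef] at h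
  refine ⟨h.1, fun X hX Y hY a b ha hb hab => ?_⟩
  have h1 := trace_mul_re_nonneg hM (Matrix.le_iff.1 (h.2 hX hY ha hb hab))
  simp only [CFC.log] at h1
  rw [mul_sub, Matrix.trace_sub, Complex.sub_re, mul_add, Matrix.trace_add, Complex.add_re,
    Matrix.mul_smul, Matrix.mul_smul, Matrix.trace_smul, Matrix.trace_smul, Complex.smul_re,
    Complex.smul_re] at h1
  exact sub_nonneg.1 h1

/-- The eigenvalues of `σ + ε` lie in `[ε, 1 + ε]` for every state `σ`, a compact interval on which
the logarithm is continuous. -/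
theorem continuous_cfc_log_add [DecidableEq ι] {ε : ℝ} (hε : 0 < ε) :
    Continuous fun σ : State ι => cfc Real.log (σ.mat + ε • (1 : Matrix ι ι ℂ)) := by
  have hmat : Continuous fun σ : State ι => σ.mat := continuous_induced_dom
  refine Continuous.cfc' (isCompact_Icc (a := ε) (b := 1 + ε)) Real.log (by fun_prop) ?_ ?_ ?_
  · intro σ
    obtain ⟨V, m, hV⟩ := σ.exists_diagonalizes
    have hH := (hV.add_smul_one ε).isHermitian
    have hd := hH.exists_diagonalizes.add_smul_one (-ε)
    rw [add_assoc, ← add_smul, add_neg_cancel, zero_smul, add_zero] at hd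
    rw [hH.spectrum_real_eq_range_eigenvalues]
    rintro _ ⟨i, rfl⟩
    have h0 := hd.nonneg i
    have h1 : hH.eigenvalues i + -ε ≤ 1 := by
      rw [← hd.sum_eq_one]
      exact Finset.single_le_sum (f := fun i => hH.eigenvalues i + -ε)
        (fun i _ => hd.nonneg i) (Finset.mem_univ i)
    constructor <;> linarith
  · exact fun x hx => (Real.continuousAt_log (hε.trans_le hx.1).ne').continuousWithinAt
  · intro σ
    obtain ⟨V, m, hV⟩ := σ.exists_diagonalizes
    exact (hV.add_smul_one ε).isHermitian

end

open Classical in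
/-- The relative entropy with a regularized second argument. -/
noncomputable def regRelEntropy (ε : ℝ) (ρ σ : State ι) : ℝ :=
  (ρ.mat * cfc Real.log ρ.mat - ρ.mat * cfc Real.log (σ.mat + ε • (1 : Matrix ι ι ℂ))).trace.re

theorem continuous_regRelEntropy {ε : ℝ} (hε : 0 < ε) (ρ : State ι) :
    Continuous (regRelEntropy ε ρ) := by
  classical
  have h := continuous_cfc_log_add (ι := ι) hε
  unfold regRelEntropy
  refine Complex.continuous_re.comp (Continuous.matrix_trace ?_)
  exact continuous_const.sub (continuous_const.mul h)

theorem State.posDef_add_smul_one [DecidableEq ι] (σ : State ι) {ε : ℝ} (hε : 0 < ε) :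
    (σ.mat + ε • (1 : Matrix ι ι ℂ)).PosDef :=
  Matrix.PosDef.posSemidef_add σ.posSemidef (Matrix.PosDef.one.smul hε)

theorem regRelEntropy_mix_le {X : Type} [Fintype X] {ε : ℝ} (hε : 0 < ε) (p : stdSimplex ℝ X)
    (ρ : State ι) (σ : X → State ι) :
    regRelEntropy ε ρ (State.mix p σ) ≤ ∑ x, p.1 x * regRelEntropy ε ρ (σ x) := by
  classical
  have h := (concaveOn_trace_mul_log ρ.posSemidef).le_map_sum (t := Finset.univ) (w := p.1)
    (p := fun x => (σ x).mat + ε • (1 : Matrix ι ι ℂ)) (fun x _ => p.2.1 x) p.2.2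
    (fun x _ => (σ x).posDef_add_smul_one hε)
  have hsum : ∑ x, p.1 x • ((σ x).mat + ε • (1 : Matrix ι ι ℂ)) =
      (State.mix p σ).mat + ε • (1 : Matrix ι ι ℂ) := by
    simp only [smul_add, Finset.sum_add_distrib, ← Finset.sum_smul, p.2.2, one_smul]
    congr 1
  rw [hsum] at h
  simp only [regRelEntropy, Matrix.trace_sub, Complex.sub_re, mul_sub, Finset.sum_sub_distrib,
    ← Finset.sum_mul, p.2.2, one_mul]
  simp only [smul_eq_mul] at h
  exact sub_le_sub_left h _

theorem regRelEntropy_eq_sum [DecidableEq ι] {ρ σ : State ι} {U V : Matrix ι ι ℂ} {l m : ι → ℝ}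
    (h : Diagonalizes U l ρ.mat) (h' : Diagonalizes V m σ.mat) (ε : ℝ) :
    regRelEntropy ε ρ σ = ∑ i, ∑ j, ‖(star U * V) i j‖ ^ 2 *
      (l i * Real.log (l i) - l i * Real.log (m j + ε)) := by
  rw [← trace_relEntropy_eq h (h'.add_smul_one ε), regRelEntropy]
  congr!

/-- Adding `ε` raises `log (m j)` where `m j > 0`; where `m j = 0` and the value is finite, nonzero
`l i` have overlap zero. -/
theorem ofReal_regRelEntropy_le {ε : ℝ} (hε : 0 < ε) (ρ σ : State ι) :
    ENNReal.ofReal (regRelEntropy ε ρ σ) ≤ relEntropy ι ρ σ := by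
  classical
  obtain ⟨U, l, hU⟩ := ρ.exists_diagonalizes
  obtain ⟨V, m, hV⟩ := σ.exists_diagonalizes
  rw [relEntropy_eq_ite hU hV, regRelEntropy_eq_sum hU hV]
  split_ifs with hc
  · refine ENNReal.ofReal_le_ofReal (Finset.sum_le_sum fun i _ => Finset.sum_le_sum fun j _ => ?_)
    by_cases hl : l i = 0
    · simp [hl]
    by_cases hm : m j = 0
    · simp [hc i j hm hl]
    have hm' : 0 < m j := (hV.nonneg j).lt_of_ne (Ne.symm hm)
    have hlog := Real.log_le_log hm' (by linarith : m j ≤ m j + ε)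
    have := hU.nonneg i
    gcongr
  · exact le_top

theorem tendsto_klTerm_add {a b : ℝ} (ha : 0 ≤ a) (hb : 0 ≤ b) :
    Tendsto (fun ε => klTerm a (b + ε)) (𝓝[>] 0) (𝓝 (klTerm a b)) := by
  have hev : ∀ᶠ ε in 𝓝[>] (0 : ℝ), ENNReal.ofReal
      (a * Real.log a - a * Real.log (b + ε) + (b + ε) - a) = klTerm a (b + ε) := by
    filter_upwards [self_mem_nhdsWithin] with ε hε
    have : 0 < b + ε := add_pos_of_nonneg_of_pos hb hε
    rw [klTerm, if_neg (fun h => this.ne' h.1)]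
  refine Tendsto.congr' hev ?_
  have hadd : Tendsto (fun ε : ℝ => b + ε) (𝓝[>] 0) (𝓝 b) := by
    have : Tendsto (fun ε : ℝ => b + ε) (𝓝 0) (𝓝 (b + 0)) := tendsto_const_nhds.add tendsto_id
    rw [add_zero] at this
    exact this.mono_left nhdsWithin_le_nhds
  by_cases h : b = 0 ∧ a ≠ 0
  · have ha' : 0 < a := ha.lt_of_ne h.2.symm
    rw [klTerm, if_pos h]
    refine ENNReal.tendsto_ofReal_atTop.comp ?_
    have hlog : Tendsto (fun ε : ℝ => -(a * Real.log (b + ε))) (𝓝[>] 0) atTop := by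
      simp only [h.1, zero_add]
      exact tendsto_neg_atBot_atTop.comp (Real.tendsto_log_nhdsGT_zero.const_mul_atBot ha')
    have hrest : Tendsto (fun ε : ℝ => a * Real.log a + (b + ε) - a) (𝓝[>] 0)
        (𝓝 (a * Real.log a + b - a)) := (tendsto_const_nhds.add hadd).sub_const a
    exact (hlog.atTop_add hrest).congr fun ε => by ring
  · rw [klTerm, if_neg h]
    refine ENNReal.tendsto_ofReal ?_
    by_cases ha0 : a = 0
    · simpa [ha0] using hadd
    · have hb0 : b ≠ 0 := fun hb0 => h ⟨hb0, ha0⟩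
      exact ((tendsto_const_nhds.sub ((hadd.log hb0).const_mul a)).add hadd).sub_const a

/-- The sums of `klTerm` with shifted eigenvalues converge to the relative entropy as `ε → 0`, and
they equal the regularized value plus a correction of dimension times `ε`, which tends to `0`. -/
theorem relEntropy_eq_iSup (ρ σ : State ι) :
    relEntropy ι ρ σ = ⨆ ε : Set.Ioi (0 : ℝ), ENNReal.ofReal (regRelEntropy ε.1 ρ σ) := by
  classical
  refine le_antisymm ?_ (iSup_le fun ε => ofReal_regRelEntropy_le ε.2 ρ σ)
  obtain ⟨U, l, hU⟩ := ρ.exists_diagonalizes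
  obtain ⟨V, m, hV⟩ := σ.exists_diagonalizes
  set s := ⨆ ε : Set.Ioi (0 : ℝ), ENNReal.ofReal (regRelEntropy ε.1 ρ σ) with hs
  have hleft : Tendsto (fun ε => ∑ i, ∑ j, ENNReal.ofReal (‖(star U * V) i j‖ ^ 2) *
      klTerm (l i) (m j + ε)) (𝓝[>] 0) (𝓝 (relEntropy ι ρ σ)) := by
    rw [relEntropy_eq_sum hU hV]
    exact tendsto_finsetSum _ fun i _ => tendsto_finsetSum _ fun j _ =>
      ENNReal.Tendsto.const_mul (tendsto_klTerm_add (hU.nonneg i) (hV.nonneg j))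
        (Or.inr ENNReal.ofReal_ne_top)
  have hright : Tendsto (fun ε : ℝ => s + ENNReal.ofReal (Fintype.card ι * ε)) (𝓝[>] 0)
      (𝓝 s) := by
    have h1 : Tendsto (fun ε : ℝ => s + ENNReal.ofReal (Fintype.card ι * ε)) (𝓝 0)
        (𝓝 (s + ENNReal.ofReal (Fintype.card ι * 0))) :=
      tendsto_const_nhds.add (ENNReal.tendsto_ofReal (tendsto_id.const_mul _))
    rw [mul_zero, ENNReal.ofReal_zero, add_zero] at h1
    exact h1.mono_left nhdsWithin_le_nhds
  refine le_of_tendsto_of_tendsto hleft hright ?_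
  filter_upwards [self_mem_nhdsWithin] with ε hε
  have hpos : ∀ j, 0 < m j + ε := fun j => add_pos_of_nonneg_of_pos (hV.nonneg j) hε
  have hnot : ∀ i j, ¬(m j + ε = 0 ∧ l i ≠ 0) := fun i j h => (hpos j).ne' h.1
  have hnn : ∀ i j, 0 ≤ ‖(star U * V) i j‖ ^ 2 *
      (l i * Real.log (l i) - l i * Real.log (m j + ε) + (m j + ε) - l i) := fun i j =>
    mul_nonneg (by positivity) (klTerm_arg_nonneg (hU.nonneg i) (hpos j).le (hnot i j))
  have hsum : ∑ i, ∑ j, ENNReal.ofReal (‖(star U * V) i j‖ ^ 2) * klTerm (l i) (m j + ε) =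
      ENNReal.ofReal (regRelEntropy ε ρ σ + Fintype.card ι * ε) := by
    rw [regRelEntropy_eq_sum hU hV, ← sum_klTerm_arg hU hV ε,
      ENNReal.ofReal_sum_of_nonneg fun i _ => Finset.sum_nonneg fun j _ => hnn i j]
    refine Finset.sum_congr rfl fun i _ => ?_
    rw [ENNReal.ofReal_sum_of_nonneg fun j _ => hnn i j]
    refine Finset.sum_congr rfl fun j _ => ?_
    rw [klTerm, if_neg (hnot i j), ENNReal.ofReal_mul (by positivity)]
  rw [hsum]
  refine ENNReal.ofReal_add_le.trans ?_
  gcongr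
  exact le_iSup (fun ε : Set.Ioi (0 : ℝ) => ENNReal.ofReal (regRelEntropy ε.1 ρ σ)) ⟨ε, hε⟩

theorem relEntropy_isLscSnd : relEntropy.IsLscSnd := by
  intro ι _ ρ
  have : relEntropy ι ρ = fun σ => ⨆ ε : Set.Ioi (0 : ℝ), ENNReal.ofReal (regRelEntropy ε.1 ρ σ) :=
    funext fun σ => relEntropy_eq_iSup ρ σ
  rw [this]
  exact lowerSemicontinuous_iSup fun ε =>
    (ENNReal.continuous_ofReal.comp (continuous_regRelEntropy ε.2 ρ)).lowerSemicontinuous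

theorem relEntropy_isConvexSnd : relEntropy.IsConvexSnd := by
  intro ι X _ _ p ρ σ
  rw [relEntropy_eq_iSup]
  refine iSup_le fun ε => ?_
  refine (ENNReal.ofReal_le_ofReal (regRelEntropy_mix_le ε.2 p ρ σ)).trans ?_
  -- Regularized values may be negative; subadditivity of `ENNReal.ofReal` is all that the
  -- truncation requires.
  refine (Finset.le_sum_of_subadditive ENNReal.ofReal ENNReal.ofReal_zero.le
    (fun _ _ => ENNReal.ofReal_add_le) _ _).trans (Finset.sum_le_sum fun x _ => ?_)
  rw [ENNReal.ofReal_mul (p.2.1 x)]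
  gcongr
  exact ofReal_regRelEntropy_le ε.2 ρ (σ x)

end QRT

theorem theorem2 {S : Type*} {dim : S → ℕ+} (F : QRT.ResourceTheory dim)
    (A B : QRT.PhysSystem S) (N : QRT.Channel (A.Idx dim) (B.Idx dim))
    (hconv : F.ConvexChannels A B) :
    (∀ d : QRT.StateFunction, d.IsContractive → d.IsFlagConcave → d.IsConvexSnd →
      (d.IsFinite ∨ d.IsLscSnd) →
        F.infSupAll A B d N = F.supInfAll A B d N ∧
        ((F.free A B).Nonempty → (∀ R, F.ConvexStates (.tensor R A)) → F.HasFreeFlags →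
          F.infSupFree A B d N = F.supInfFree A B d N)) ∧
    F.relEntropyAll A B N = F.supInfAll A B QRT.relEntropy N ∧
    ((F.free A B).Nonempty → (∀ R, F.ConvexStates (.tensor R A)) → F.HasFreeFlags →
      F.relEntropyFree A B N = F.supInfFree A B QRT.relEntropy N) := by
  refine ⟨fun d hd hflag hsnd hreg => ?_, ?_, ?_⟩
  · have hreg' := hreg.imp_left hd.exists_forall_le
    exact ⟨F.infSupAll_eq_supInfAll A B N hconv (hd.isAncillaStable hflag) hsnd hreg',
      F.infSupFree_eq_supInfFree A B N hconv (hd.isAncillaStable hflag) hsnd hreg'⟩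
  · exact F.infSupAll_eq_supInfAll A B N hconv QRT.relEntropy_isAncillaStable
      QRT.relEntropy_isConvexSnd (Or.inr QRT.relEntropy_isLscSnd)
  · exact F.infSupFree_eq_supInfFree A B N hconv QRT.relEntropy_isAncillaStable
      QRT.relEntropy_isConvexSnd (Or.inr QRT.relEntropy_isLscSnd)
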